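/- Let $P_0=-\Delta$ on $L^2(\mathbb R^n)$, and for $V\in L^\infty_{\mathrm{comp}}(\mathbb R^n;\mathbb R)$ (bounded, real-valued, compactly supported) and $t>0$ let $$W_2(t)=\int_{0<s_1<s_2<t}e^{-(t-s_2)P_0}\,V\,e^{-(s_2-s_1)P_0}\,V\,e^{-s_1P_0}\,ds_1\,ds_2 ,$$ which is an operator of trace class on $L^2(\mathbb R^n)$. Let $|D|^j=(-\Delta)^{j/2}$ be the Fourier multiplier with symbol $|\xi|^j$. There are real constants $a_j\neq 0$ $(j=0,1,2,\dots)$, not depending on $n$, $m$ or $V$, such that the following holds for all $n\ge 1$, all $m\in\{0,1,2,\dots\}$ and all $V\in L^\infty_{\mathrm{comp}}(\mathbb R^n;\mathbb R)$. (i) If $V\in H^m(\mathbb R^n)$, then for $t>0$ $$\mathrm{tr}\,W_2(t)=(4\pi t)^{-n/2}\Bigl(\sum_{j=0}^m c_{2,2+j}\,t^{2+j}+\varepsilon(t)\,t^{2+m}\Bigr),\qquad \lim_{t\to0^+}\varepsilon(t)=0,\qquad c_{2,2+j}=a_j\,\bigl\||D|^jV\bigr\|_{L^2}^2 .\tag{1}$$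 (ii) Conversely, if $V\in H^{m-1}(\mathbb R^n)$ and if there are constants $c_{2,2},\dots,c_{2,1+m}$ and $C$ and a function $r$ with $|r(t)|\le C$ for $0<t\le 1$ such that $$\mathrm{tr}\,W_2(t)=(4\pi t)^{-n/2}\Bigl(\sum_{j=0}^{m-1} c_{2,2+j}\,t^{2+j}+r(t)\,t^{2+m}\Bigr),\qquad 0<t\le1,$$ then $V\in H^m(\mathbb R^n)$, and hence (1) holds. -/

import Mathlib

open MeasureTheory Filter Topology
open scoped ENNReal SchwartzMap FourierTransform

noncomputable section

namespace HeatTrace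

/-- The Hilbert space `L²(ℝⁿ; ℂ)` for Lebesgue measure. -/
abbrev L2 (n : ℕ) : Type :=
  Lp ℂ 2 (volume : Measure (EuclideanSpace ℝ (Fin n)))

/-- The space `L^∞(ℝⁿ; ℂ)`. -/
abbrev Linf (n : ℕ) : Type :=
  Lp ℂ ∞ (volume : Measure (EuclideanSpace ℝ (Fin n)))

/-- The bounded operator `f ↦ g f` on `L²(ℝⁿ; ℂ)` for `g` in `L^∞(ℝⁿ; ℂ)`. -/
def mulOp {n : ℕ} (g : Linf n) : L2 n →L[ℂ] L2 n :=
  (ContinuousLinearMap.mul ℂ ℂ).holderL volume ∞ 2 2 g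

/-- The function `ξ ↦ exp (-s |2πξ|²)`; negative `s` are replaced by `0`, so that the function is
always bounded. -/
def heatSymbol {n : ℕ} (s : ℝ) (ξ : EuclideanSpace ℝ (Fin n)) : ℂ :=
  ((Real.exp (-(max s 0 * (2 * Real.pi * ‖ξ‖) ^ 2)) : ℝ) : ℂ)

theorem memLp_heatSymbol {n : ℕ} (s : ℝ) :
    MemLp (heatSymbol (n := n) s) ∞ volume := by
  refine memLp_top_of_bound ?_ 1 (Eventually.of_forall fun ξ => ?_)
  · refine Continuous.aestronglyMeasurable ?_
    unfold heatSymbol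
    fun_prop
  · rw [heatSymbol, Complex.norm_real, Real.norm_of_nonneg (Real.exp_pos _).le,
      Real.exp_le_one_iff, neg_nonpos]
    positivity

/-- The free heat semigroup `e^{-s P₀}`, `P₀ = -Δ`, `s ≥ 0`, on `L²(ℝⁿ; ℂ)`. As Mathlib's Fourier
transform has the kernel `exp (-2πi ⟨x, ξ⟩)`, it turns `-Δ` into multiplication by `|2πξ|²`. -/
def heatOp {n : ℕ} (s : ℝ) : L2 n →L[ℂ] L2 n :=
  ((Lp.fourierTransformₗᵢ (EuclideanSpace ℝ (Fin n)) ℂ).symm.toContinuousLinearEquiv :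
      L2 n →L[ℂ] L2 n) ∘L
    mulOp (memLp_heatSymbol s).toLp ∘L
    ((Lp.fourierTransformₗᵢ (EuclideanSpace ℝ (Fin n)) ℂ).toContinuousLinearEquiv :
      L2 n →L[ℂ] L2 n)

/-- Multiplication by a real potential `V` in `L^∞` as an operator on `L²(ℝⁿ; ℂ)`. -/
def potOp {n : ℕ} (V : EuclideanSpace ℝ (Fin n) → ℝ) (hV : MemLp V ∞ volume) :
    L2 n →L[ℂ] L2 n :=
  mulOp (hV.ofReal (K := ℂ)).toLp

/-- The second term of the Duhamel expansion of `e^{-t P_V} - e^{-t P₀}`,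
`W₂(t) = ∫_{0 < s₁ < s₂ < t} e^{-(t-s₂)P₀} V e^{-(s₂-s₁)P₀} V e^{-s₁P₀} ds₁ ds₂`.
The integrand is bounded and norm continuous on the open simplex (all three times are positive
there), so this is a Bochner integral in the Banach space of bounded operators. -/
def W2 {n : ℕ} (V : EuclideanSpace ℝ (Fin n) → ℝ) (hV : MemLp V ∞ volume) (t : ℝ) :
    L2 n →L[ℂ] L2 n :=
  ∫ s in {s : ℝ × ℝ | 0 < s.1 ∧ s.1 < s.2 ∧ s.2 < t},
    heatOp (t - s.2) ∘L potOp V hV ∘L heatOp (s.2 - s.1) ∘L potOp V hV ∘L heatOp s.1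

/-- `T` is of trace class: the sums `∑ |⟨f_i, T e_i⟩|` over all pairs of finite orthonormal systems
are bounded (their supremum is the trace norm of `T`). -/
def IsTraceClass {H : Type*} [NormedAddCommGroup H] [InnerProductSpace ℂ H]
    (T : H →L[ℂ] H) : Prop :=
  ∃ C : ℝ, ∀ (N : ℕ) (e f : Fin N → H), Orthonormal ℂ e → Orthonormal ℂ f →
    ∑ i, ‖inner ℂ (f i) (T (e i))‖ ≤ C

/-- The trace `∑ ⟨b_i, T b_i⟩` over a Hilbert basis `b`. For operators of trace class the series
converges absolutely and its sum is the same for all Hilbert bases. -/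
def opTrace {H : Type*} [NormedAddCommGroup H] [InnerProductSpace ℂ H] [CompleteSpace H]
    (T : H →L[ℂ] H) : ℂ :=
  let b := (exists_hilbertBasis ℂ H).choose_spec.choose
  ∑' i, inner ℂ (b i) (T (b i))

theorem memLp_two_of_hasCompactSupport {n : ℕ} {V : EuclideanSpace ℝ (Fin n) → ℝ}
    (hV : MemLp V ∞ volume) (hVc : HasCompactSupport V) :
    MemLp (fun x => (V x : ℂ)) 2 volume := by
  have h : MemLp V 2 volume :=
    hV.mono_exponent_of_measure_support_ne_top (s := tsupport V)
      (fun _ hx => image_eq_zero_of_notMem_tsupport hx) hVc.isCompact.measure_lt_top.ne le_top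
  exact h.ofReal (K := ℂ)

/-- A potential in `L^∞_comp(ℝⁿ; ℝ)` as an element of `L²(ℝⁿ; ℂ)`. -/
def potL2 {n : ℕ} (V : EuclideanSpace ℝ (Fin n) → ℝ) (hV : MemLp V ∞ volume)
    (hVc : HasCompactSupport V) : L2 n :=
  (memLp_two_of_hasCompactSupport hV hVc).toLp

/-- `f ∈ H^s(ℝⁿ)`, for `f` in `L²(ℝⁿ; ℂ)` regarded as a tempered distribution. -/
def MemH {n : ℕ} (s : ℝ) (f : L2 n) : Prop :=
  TemperedDistribution.MemSobolev s 2 (f : 𝓢'(EuclideanSpace ℝ (Fin n), ℂ))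

open scoped Classical in
/-- The operator `|D|^j = (-Δ)^{j/2}` on `L²(ℝⁿ; ℂ)`, whose domain `{f | |2πξ|^j 𝓕 f ∈ L²}` is
`H^j(ℝⁿ)`; by convention the value is `0` outside the domain. -/
def absD {n : ℕ} (j : ℕ) (f : L2 n) : L2 n :=
  if h : MemLp (fun ξ : EuclideanSpace ℝ (Fin n) =>
      (((2 * Real.pi * ‖ξ‖) ^ j : ℝ) : ℂ) * (𝓕 f : L2 n) ξ) 2 volume
  then 𝓕⁻ h.toLp else 0

/-- The expansion
`tr W₂(t) = (4πt)^{-n/2} (∑_{j=0}^m a_j ‖|D|^j V‖² t^{2+j} + ε(t) t^{2+m})` for `t > 0`, with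
`ε(t) → 0` as `t → 0+`. -/
def TraceExpansion {n : ℕ} (a : ℕ → ℝ) (m : ℕ) (V : EuclideanSpace ℝ (Fin n) → ℝ)
    (hV : MemLp V ∞ volume) (hVc : HasCompactSupport V) : Prop :=
  ∃ ε : ℝ → ℂ, Tendsto ε (𝓝[>] 0) (𝓝 0) ∧ ∀ t : ℝ, 0 < t →
    opTrace (W2 V hV t) = (((4 * Real.pi * t) ^ (-(n : ℝ) / 2) : ℝ) : ℂ) *
      (∑ j ∈ Finset.range (m + 1),
          ((a j * ‖absD j (potL2 V hV hVc)‖ ^ 2 : ℝ) : ℂ) * (t : ℂ) ^ (2 + j)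
        + ε t * (t : ℂ) ^ (2 + m))

end HeatTrace

end

/-! Write `p_s` for the heat kernel. By cyclicity, the trace of `e^{-aP₀} V e^{-bP₀} V e^{-cP₀}` is
the double integral of `V(x) V(y) p_{a+c}(x-y) p_b(x-y)`. When `a + b + c = t`, the product of the
two Gaussians is `(4πt)^{-n/2}` times a single Gaussian at time `(a+c)b/t` (`heatKer_mul_heatKer`),
so the trace is `(4πt)^{-n/2} ⟨V, e^{-((a+c)b/t)P₀} V⟩`.

Integrating over the simplex of times, rescaling by `t` and applying Plancherel turns `tr W₂(t)`
into `(4πt)^{-n/2} t²` times the integral of `exp(-t w(s) |2πξ|²)` against `ds |𝓕V(ξ)|² dξ` over the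
unit simplex and frequency space, where `w(s) = σ(1-σ)`, `σ = s₂ - s₁` (`opTrace_W2_eq_laplace`).
This is the Laplace transform of a finite positive measure. Its moments factor into `∫ w^j`, which
is positive and universal, and `‖|D|^j V‖²`. Hence `a_j = (-1)^j/j! ∫ w^j ≠ 0`, and `V ∈ H^m`
exactly when the moment of order `m` is finite.

What remains concerns Laplace transforms only. A finite moment of order `m` gives the Taylor
expansion by dominated convergence (`laplace_expansion`). Conversely, the Taylor remainders of
`exp(-x)` have a fixed sign on `x ≥ 0`, so a bound on the integrated remainder gives, by Fatou, the
next moment (`integrable_pow_succ_of_laplace_expansion`).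

The analytic work is to justify the trace formula. The heat operator is a weak integral of rank-one
operators built from kernel vectors; for these the trace norm is bounded by Cauchy–Schwarz and
Bessel, and the trace is found by Parseval. At least one of the three times is at least `t/3`, which
bounds the trace norm uniformly over the simplex and lets the trace pass through the Bochner
integral. -/

noncomputable section

namespace HeatTrace

/-! ### Taylor remainders of `exp (-x)`. -/

/-- The remainder of order `m` in the Taylor expansion of `exp (-x)`, normalized to be
nonnegative. -/
def expRem (m : ℕ) (x : ℝ) : ℝ :=
  (-1) ^ m * (Real.exp (-x) - ∑ j ∈ Finset.range m, (-x) ^ j / (j.factorial : ℝ))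

theorem expRem_zero (x : ℝ) : expRem 0 x = Real.exp (-x) := by
  simp [expRem]

theorem expRem_succ (m : ℕ) (x : ℝ) :
    expRem (m + 1) x = x ^ m / (m.factorial : ℝ) - expRem m x := by
  have h : (-1 : ℝ) ^ m * (-x) ^ m = x ^ m := by rw [← mul_pow]; simp
  rw [expRem, expRem, Finset.sum_range_succ, ← h]
  ring

theorem exp_neg_eq_sum_add_expRem (m : ℕ) (x : ℝ) :
    Real.exp (-x) = ∑ j ∈ Finset.range m, (-x) ^ j / (j.factorial : ℝ) + (-1) ^ m * expRem m x := by
  have h : (-1 : ℝ) ^ m * (-1) ^ m = 1 := by rw [← mul_pow]; simp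
  rw [expRem, ← mul_assoc, h]
  ring

theorem continuous_expRem (m : ℕ) : Continuous (expRem m) := by
  unfold expRem
  fun_prop

theorem hasDerivAt_expRem_succ (m : ℕ) (x : ℝ) :
    HasDerivAt (expRem (m + 1)) (expRem m x) x := by
  induction m with
  | zero =>
    have h : expRem (0 + 1) = fun x => 1 - Real.exp (-x) := by
      funext x; rw [expRem_succ, expRem_zero]; simp
    rw [h, expRem_zero]
    have := ((Real.hasDerivAt_exp (-x)).comp x (hasDerivAt_neg x)).const_sub 1
    simpa [Function.comp_def] using this
  | succ m ih =>
    have h : expRem (m + 1 + 1) = fun x => x ^ (m + 1) / ((m + 1).factorial : ℝ) -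
        expRem (m + 1) x := by
      funext x; rw [expRem_succ]
    rw [h]
    have h1 := ((hasDerivAt_pow (m + 1) x).div_const ((m + 1).factorial : ℝ)).sub ih
    refine h1.congr_deriv ?_
    rw [expRem_succ]
    congr 1
    have : (m.factorial : ℝ) ≠ 0 := by positivity
    rw [Nat.factorial_succ]
    push_cast
    field_simp

/-- Each remainder of positive order vanishes at `0` and has the previous one as derivative, so the
sign propagates by induction. This is the positivity that makes the converse direction work. -/
theorem expRem_nonneg (m : ℕ) {x : ℝ} (hx : 0 ≤ x) : 0 ≤ expRem m x := by
  induction m generalizing x with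
  | zero => rw [expRem_zero]; positivity
  | succ m ih =>
    have hmono : MonotoneOn (expRem (m + 1)) (Set.Ici 0) := by
      refine monotoneOn_of_deriv_nonneg (convex_Ici 0) (continuous_expRem _).continuousOn
        (fun y _ => (hasDerivAt_expRem_succ m y).differentiableAt.differentiableWithinAt)
        fun y hy => ?_
      rw [(hasDerivAt_expRem_succ m y).deriv]
      rw [interior_Ici] at hy
      exact ih hy.le
    have h0 : expRem (m + 1) 0 = 0 := by
      rw [expRem, Finset.sum_range_succ']
      simp
    rw [← h0]
    exact hmono Set.self_mem_Ici hx hx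

theorem expRem_le (m : ℕ) {x : ℝ} (hx : 0 ≤ x) : expRem m x ≤ x ^ m / (m.factorial : ℝ) := by
  have := expRem_nonneg (m + 1) hx
  rw [expRem_succ] at this
  linarith

/-- This bound costs one power of `x` less than `expRem_le`, so the remainder of order `m + 1` is
integrable when only the moment of order `m` is finite. -/
theorem expRem_succ_le (m : ℕ) {x : ℝ} (hx : 0 ≤ x) :
    expRem (m + 1) x ≤ x ^ m / (m.factorial : ℝ) := by
  have := expRem_nonneg m hx
  rw [expRem_succ]
  linarith

/-! ### Laplace transforms of finite measures: expansion at zero and its converse. -/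

section Laplace

variable {X : Type*} [MeasurableSpace X] {M : Measure X} [IsFiniteMeasure M] {F : X → ℝ}

theorem integrable_pow_of_le (hF : Measurable F) (hF0 : ∀ x, 0 ≤ F x) {j m : ℕ} (hjm : j ≤ m)
    (hm : Integrable (fun x => F x ^ m) M) : Integrable (fun x => F x ^ j) M := by
  refine ((integrable_const (1 : ℝ)).add hm).mono' (hF.pow_const j).aestronglyMeasurable
    (Eventually.of_forall fun x => ?_)
  rw [Real.norm_of_nonneg (pow_nonneg (hF0 x) j)]
  simp only [Pi.add_apply]
  rcases le_total (F x) 1 with h | h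
  · have := pow_le_one₀ (hF0 x) h (n := j)
    have := pow_nonneg (hF0 x) m
    linarith
  · have := pow_le_pow_right₀ h hjm
    linarith

theorem integrable_exp_neg_mul (hF : Measurable F) (hF0 : ∀ x, 0 ≤ F x) {t : ℝ} (ht : 0 ≤ t) :
    Integrable (fun x => Real.exp (-(t * F x))) M := by
  refine (integrable_const (1 : ℝ)).mono' (by fun_prop) (Eventually.of_forall fun x => ?_)
  rw [Real.norm_of_nonneg (Real.exp_pos _).le, Real.exp_le_one_iff, neg_nonpos]
  exact mul_nonneg ht (hF0 x)

/-- The Taylor coefficients at `0` of `t ↦ ∫ exp (-t F)`. -/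
def laplaceCoeff (M : Measure X) (F : X → ℝ) (j : ℕ) : ℝ :=
  (-1) ^ j / (j.factorial : ℝ) * ∫ x, F x ^ j ∂M

theorem integral_exp_neg_mul_eq (hF : Measurable F) (hF0 : ∀ x, 0 ≤ F x) {m : ℕ}
    (hm : Integrable (fun x => F x ^ m) M) {t : ℝ} (ht : 0 ≤ t) :
    Integrable (fun x => expRem (m + 1) (t * F x)) M ∧
    ∫ x, Real.exp (-(t * F x)) ∂M = ∑ j ∈ Finset.range (m + 1), laplaceCoeff M F j * t ^ j +
      (-1) ^ (m + 1) * ∫ x, expRem (m + 1) (t * F x) ∂M := by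
  have hR : Integrable (fun x => expRem (m + 1) (t * F x)) M := by
    refine (hm.const_mul (t ^ m / (m.factorial : ℝ))).mono'
      ((continuous_expRem _).measurable.comp (hF.const_mul t)).aestronglyMeasurable
      (Eventually.of_forall fun x => ?_)
    have hx : 0 ≤ t * F x := mul_nonneg ht (hF0 x)
    rw [Real.norm_of_nonneg (expRem_nonneg _ hx)]
    refine (expRem_succ_le m hx).trans (le_of_eq ?_)
    rw [mul_pow]; ring
  refine ⟨hR, ?_⟩
  have hj : ∀ j ∈ Finset.range (m + 1),
      Integrable (fun x => (-(t * F x)) ^ j / (j.factorial : ℝ)) M := by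
    intro j hj
    have := (integrable_pow_of_le hF hF0 (Nat.lt_succ_iff.1 (Finset.mem_range.1 hj)) hm).const_mul
      ((-t) ^ j / (j.factorial : ℝ))
    refine this.congr (Eventually.of_forall fun x => ?_)
    simp only
    rw [← neg_mul, mul_pow]; ring
  simp_rw [exp_neg_eq_sum_add_expRem (m + 1)]
  rw [integral_add (integrable_finsetSum _ hj) (hR.const_mul _), integral_finsetSum _ hj,
    integral_const_mul]
  congr 1
  refine Finset.sum_congr rfl fun j _ => ?_
  rw [laplaceCoeff, mul_right_comm, ← integral_const_mul]
  refine integral_congr_ae (Eventually.of_forall fun x => ?_)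
  simp only
  rw [← neg_mul, mul_pow, neg_pow t]; ring

-- Dominated convergence: the majorant is `F ^ m / m!`, while pointwise the quotient is at most `t *
-- F ^ (m + 1) / (m + 1)!`, where no integrability of `F ^ (m + 1)` is needed.
omit [IsFiniteMeasure M] in
theorem tendsto_integral_expRem (hF : Measurable F) (hF0 : ∀ x, 0 ≤ F x) {m : ℕ}
    (hm : Integrable (fun x => F x ^ m) M) :
    Tendsto (fun t : ℝ => (∫ x, expRem (m + 1) (t * F x) ∂M) / t ^ m) (𝓝[>] 0) (𝓝 0) := by
  simp_rw [← integral_div]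
  suffices Tendsto (fun t : ℝ => ∫ x, expRem (m + 1) (t * F x) / t ^ m ∂M) (𝓝[>] 0)
      (𝓝 (∫ _, (0 : ℝ) ∂M)) by rwa [integral_zero] at this
  refine tendsto_integral_filter_of_dominated_convergence (fun x => F x ^ m / (m.factorial : ℝ))
    (Eventually.of_forall fun t => ?_) ?_ (hm.div_const _) (Eventually.of_forall fun x => ?_)
  · exact (((continuous_expRem _).measurable.comp (hF.const_mul t)).div_const _).aestronglyMeasurable
  · filter_upwards [self_mem_nhdsWithin] with t ht
    refine Eventually.of_forall fun x => ?_
    have ht : (0 : ℝ) < t := ht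
    have hx : 0 ≤ t * F x := mul_nonneg ht.le (hF0 x)
    rw [Real.norm_of_nonneg (div_nonneg (expRem_nonneg _ hx) (by positivity)),
      div_le_iff₀ (by positivity)]
    refine (expRem_succ_le m hx).trans (le_of_eq ?_)
    rw [mul_pow]; ring
  · have h1 : Tendsto (fun t : ℝ => t * (F x ^ (m + 1) / ((m + 1).factorial : ℝ)))
        (𝓝[>] 0) (𝓝 0) := by
      have : Tendsto (fun t : ℝ => t * (F x ^ (m + 1) / ((m + 1).factorial : ℝ)))
          (𝓝 0) (𝓝 (0 * (F x ^ (m + 1) / ((m + 1).factorial : ℝ)))) :=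
        tendsto_id.mul_const _
      rw [zero_mul] at this
      exact this.mono_left nhdsWithin_le_nhds
    refine tendsto_of_tendsto_of_tendsto_of_le_of_le' tendsto_const_nhds h1 ?_ ?_
    · filter_upwards [self_mem_nhdsWithin] with t ht
      have ht : (0 : ℝ) < t := ht
      exact div_nonneg (expRem_nonneg _ (mul_nonneg ht.le (hF0 x))) (by positivity)
    · filter_upwards [self_mem_nhdsWithin] with t ht
      have ht : (0 : ℝ) < t := ht
      rw [div_le_iff₀ (by positivity)]
      refine (expRem_le _ (mul_nonneg ht.le (hF0 x))).trans (le_of_eq ?_)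
      rw [mul_pow]; ring

/-- A polynomial of degree at most `m` which is `o(t ^ m)` at `0+` vanishes. -/
theorem eq_zero_of_tendsto_sum_div_pow (m : ℕ) (d : ℕ → ℂ)
    (h : Tendsto (fun t : ℝ => (∑ j ∈ Finset.range (m + 1), d j * (t : ℂ) ^ j) / (t : ℂ) ^ m)
      (𝓝[>] 0) (𝓝 0)) : ∀ j ≤ m, d j = 0 := by
  have key : ∀ k, k ≤ m → (∀ j < k, d j = 0) → d k = 0 := by
    intro k hk hlt
    have h2 : Tendsto (fun t : ℝ => (∑ j ∈ Finset.range (m + 1), d j * (t : ℂ) ^ j) / (t : ℂ) ^ k)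
        (𝓝[>] 0) (𝓝 0) := by
      have h3 : Tendsto (fun t : ℝ => (t : ℂ) ^ (m - k)) (𝓝[>] 0) (𝓝 ((0 : ℝ) ^ (m - k) : ℂ)) := by
        have : Continuous fun t : ℝ => (t : ℂ) ^ (m - k) := by fun_prop
        simpa using (this.tendsto 0).mono_left nhdsWithin_le_nhds
      have h4 := h.mul h3
      rw [zero_mul] at h4
      refine h4.congr' ?_
      filter_upwards [self_mem_nhdsWithin] with t ht
      have ht : (t : ℂ) ≠ 0 := Complex.ofReal_ne_zero.2 (ne_of_gt ht)
      have : (t : ℂ) ^ m = (t : ℂ) ^ (m - k) * (t : ℂ) ^ k := by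
        rw [← pow_add, Nat.sub_add_cancel hk]
      rw [this]
      field_simp
    -- Natural subtraction makes `j - k = 0` for `j < k`; the indicator removes these terms, whose
    -- coefficients already vanish.
    have h5 : Tendsto (fun t : ℝ => (∑ j ∈ Finset.range (m + 1), d j * (t : ℂ) ^ j) / (t : ℂ) ^ k)
        (𝓝[>] 0) (𝓝 (∑ j ∈ Finset.range (m + 1), d j * (0 : ℂ) ^ (j - k) *
          if j < k then 0 else 1)) := by
      have h6 : Tendsto (fun t : ℝ => ∑ j ∈ Finset.range (m + 1), d j * (t : ℂ) ^ (j - k) *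
          if j < k then 0 else 1) (𝓝[>] 0) (𝓝 (∑ j ∈ Finset.range (m + 1), d j * (0 : ℂ) ^ (j - k) *
          if j < k then 0 else 1)) := by
        have : Continuous (fun t : ℝ => ∑ j ∈ Finset.range (m + 1), d j * (t : ℂ) ^ (j - k) *
          if j < k then 0 else 1) := by fun_prop
        simpa using (this.tendsto 0).mono_left nhdsWithin_le_nhds
      refine h6.congr' ?_
      filter_upwards [self_mem_nhdsWithin] with t ht
      have ht : (t : ℂ) ≠ 0 := Complex.ofReal_ne_zero.2 (ne_of_gt ht)
      rw [Finset.sum_div]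
      refine Finset.sum_congr rfl fun j _ => ?_
      split_ifs with hj
      · simp [hlt j hj]
      · have : (t : ℂ) ^ j = (t : ℂ) ^ (j - k) * (t : ℂ) ^ k := by
          rw [← pow_add, Nat.sub_add_cancel (not_lt.1 hj)]
        rw [this]
        field_simp
    have h7 := tendsto_nhds_unique h5 h2
    rw [Finset.sum_eq_single k] at h7
    · simpa using h7
    · intro j _ hjk
      rcases lt_or_gt_of_ne hjk with hj | hj
      · simp [hj]
      · rw [zero_pow (by omega)]; simp
    · intro hk'
      exact absurd (Finset.mem_range.2 (by omega)) hk'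
  intro j
  induction j using Nat.strong_induction_on with
  | _ j ih => exact fun hj => key j hj fun i hi => ih i hi (by omega)

/-- The Taylor expansion at `0+` of order `m` of the Laplace transform of a finite measure with
finite moment of order `m`. -/
theorem laplace_expansion (hF : Measurable F) (hF0 : ∀ x, 0 ≤ F x) {m : ℕ}
    (hm : Integrable (fun x => F x ^ m) M) :
    ∃ ε : ℝ → ℝ, Tendsto ε (𝓝[>] 0) (𝓝 0) ∧ ∀ t, 0 < t →
      ∫ x, Real.exp (-(t * F x)) ∂M =
        ∑ j ∈ Finset.range (m + 1), laplaceCoeff M F j * t ^ j + ε t * t ^ m := by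
  refine ⟨fun t => (-1) ^ (m + 1) * ((∫ x, expRem (m + 1) (t * F x) ∂M) / t ^ m), ?_, ?_⟩
  · simpa using (tendsto_integral_expRem hF hF0 hm).const_mul ((-1) ^ (m + 1))
  · intro t ht
    rw [(integral_exp_neg_mul_eq hF hF0 hm ht.le).2]
    have : t ^ m ≠ 0 := by positivity
    field_simp

/-- If the Laplace transform of a finite measure has an asymptotic expansion at `0+` with a
remainder `O(t ^ (m + 1))` and the moment of order `m` is finite, then so is the one of order
`m + 1`. -/
theorem integrable_pow_succ_of_laplace_expansion (hF : Measurable F) (hF0 : ∀ x, 0 ≤ F x) {m : ℕ}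
    (hm : Integrable (fun x => F x ^ m) M) (c : ℕ → ℂ) (r : ℝ → ℂ) (C : ℝ)
    (h : ∀ t : ℝ, 0 < t → t ≤ 1 → ‖r t‖ ≤ C ∧ ((∫ x, Real.exp (-(t * F x)) ∂M : ℝ) : ℂ) =
      ∑ j ∈ Finset.range (m + 1), c j * (t : ℂ) ^ j + r t * (t : ℂ) ^ (m + 1)) :
    Integrable (fun x => F x ^ (m + 1)) M := by
  have hd : ∀ t : ℝ, 0 < t → t ≤ 1 →
      ∑ j ∈ Finset.range (m + 1), (c j - laplaceCoeff M F j) * (t : ℂ) ^ j =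
        (((-1) ^ (m + 1) * ∫ x, expRem (m + 1) (t * F x) ∂M : ℝ) : ℂ) -
          r t * (t : ℂ) ^ (m + 1) := by
    intro t ht ht1
    have h1 := (h t ht ht1).2
    rw [(integral_exp_neg_mul_eq hF hF0 hm ht.le).2] at h1
    simp_rw [sub_mul, Finset.sum_sub_distrib]
    push_cast at h1 ⊢
    linear_combination -h1
  have hnear : ∀ᶠ t : ℝ in 𝓝[>] 0, 0 < t ∧ t ≤ 1 := by
    filter_upwards [Ioc_mem_nhdsGT (zero_lt_one (α := ℝ))] with t ht using ht
  -- The true expansion of order `m` and the assumed one differ by `o(t ^ m)`, which forces their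
  -- coefficients to agree.
  have hzero : ∀ j ≤ m, c j - laplaceCoeff M F j = 0 := by
    refine eq_zero_of_tendsto_sum_div_pow m (fun j => c j - laplaceCoeff M F j) ?_
    have h1 : Tendsto (fun t : ℝ => (((-1) ^ (m + 1) *
        ((∫ x, expRem (m + 1) (t * F x) ∂M) / t ^ m) : ℝ) : ℂ)) (𝓝[>] 0) (𝓝 0) := by
      have := (tendsto_integral_expRem hF hF0 hm).const_mul ((-1) ^ (m + 1))
      rw [mul_zero] at this
      have := (Complex.continuous_ofReal.tendsto 0).comp this
      rwa [Complex.ofReal_zero] at this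
    have h2 : Tendsto (fun t : ℝ => r t * (t : ℂ)) (𝓝[>] 0) (𝓝 0) := by
      have h3 : Tendsto (fun t : ℝ => C * t) (𝓝[>] 0) (𝓝 0) := by
        have : Continuous fun t : ℝ => C * t := by fun_prop
        simpa using (this.tendsto 0).mono_left nhdsWithin_le_nhds
      refine squeeze_zero_norm' ?_ h3
      filter_upwards [hnear] with t ht
      rw [norm_mul, Complex.norm_real, Real.norm_of_nonneg ht.1.le]
      exact mul_le_mul_of_nonneg_right (h t ht.1 ht.2).1 ht.1.le
    have h4 := h1.sub h2
    rw [sub_zero] at h4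
    refine h4.congr' ?_
    filter_upwards [hnear] with t ht
    have ht0 : (t : ℂ) ≠ 0 := Complex.ofReal_ne_zero.2 ht.1.ne'
    rw [hd t ht.1 ht.2]
    push_cast
    field_simp
    ring
  have hbound : ∀ t : ℝ, 0 < t → t ≤ 1 →
      ∫ x, expRem (m + 1) (t * F x) / t ^ (m + 1) ∂M ≤ C := by
    intro t ht ht1
    have h1 := hd t ht ht1
    rw [Finset.sum_eq_zero fun j hj => by
      rw [hzero j (Nat.lt_succ_iff.1 (Finset.mem_range.1 hj)), zero_mul]] at h1
    have h2 : ‖(((-1) ^ (m + 1) * ∫ x, expRem (m + 1) (t * F x) ∂M : ℝ) : ℂ)‖ =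
        ‖r t * (t : ℂ) ^ (m + 1)‖ := by
      rw [sub_eq_zero.1 h1.symm]
    rw [Complex.norm_real, norm_mul, norm_mul, norm_pow, norm_pow, Complex.norm_real,
      Real.norm_of_nonneg ht.le, norm_neg, norm_one, one_pow, one_mul] at h2
    rw [integral_div, div_le_iff₀ (by positivity)]
    calc _ ≤ ‖∫ x, expRem (m + 1) (t * F x) ∂M‖ := Real.le_norm_self _
      _ = _ := h2
      _ ≤ _ := mul_le_mul_of_nonneg_right (h t ht ht1).1 (by positivity)
  -- The remainder lies between its first term and the difference of its first two terms; the lower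
  -- bound is `expRem_le` at order `m + 2`.
  have hpt : ∀ x, Tendsto (fun t : ℝ => expRem (m + 1) (t * F x) / t ^ (m + 1)) (𝓝[>] 0)
      (𝓝 (F x ^ (m + 1) / ((m + 1).factorial : ℝ))) := by
    intro x
    have h1 : Tendsto (fun t : ℝ => F x ^ (m + 1) / ((m + 1).factorial : ℝ) -
        t * (F x ^ (m + 2) / ((m + 2).factorial : ℝ)))
        (𝓝[>] 0) (𝓝 (F x ^ (m + 1) / ((m + 1).factorial : ℝ))) := by
      have : Continuous (fun t : ℝ => F x ^ (m + 1) / ((m + 1).factorial : ℝ) -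
        t * (F x ^ (m + 2) / ((m + 2).factorial : ℝ))) := by fun_prop
      simpa using (this.tendsto 0).mono_left nhdsWithin_le_nhds
    refine tendsto_of_tendsto_of_tendsto_of_le_of_le' h1 tendsto_const_nhds ?_ ?_
    · filter_upwards [self_mem_nhdsWithin] with t ht
      have ht : (0 : ℝ) < t := ht
      have h2 := expRem_le (m + 2) (mul_nonneg ht.le (hF0 x))
      rw [expRem_succ] at h2
      rw [le_div_iff₀ (by positivity)]
      rw [mul_pow, mul_pow] at h2
      have e : (F x ^ (m + 1) / ((m + 1).factorial : ℝ) -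
          t * (F x ^ (m + 2) / ((m + 2).factorial : ℝ))) * t ^ (m + 1) =
          t ^ (m + 1) * F x ^ (m + 1) / ((m + 1).factorial : ℝ) -
          t ^ (m + 2) * F x ^ (m + 2) / ((m + 2).factorial : ℝ) := by ring
      linarith
    · filter_upwards [self_mem_nhdsWithin] with t ht
      have ht : (0 : ℝ) < t := ht
      rw [div_le_iff₀ (by positivity)]
      refine (expRem_le _ (mul_nonneg ht.le (hF0 x))).trans (le_of_eq ?_)
      rw [mul_pow]; ring
  set u : ℕ → ℝ := fun k => 1 / ((k : ℝ) + 1) with hu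
  have hu0 : ∀ k, 0 < u k ∧ u k ≤ 1 := fun k => by
    constructor
    · positivity
    · rw [hu]; simp only; rw [div_le_one (by positivity)]; linarith [Nat.cast_nonneg (α := ℝ) k]
  have hut : Tendsto u atTop (𝓝[>] 0) :=
    tendsto_nhdsWithin_iff.2 ⟨tendsto_one_div_add_atTop_nhds_zero_nat,
      Eventually.of_forall fun k => (hu0 k).1⟩
  -- Fatou along the sequence `u k → 0+`, applied to the nonnegative normalized remainders, whose
  -- integrals are at most `C`.
  have hfin : ∫⁻ x, ENNReal.ofReal (F x ^ (m + 1) / ((m + 1).factorial : ℝ)) ∂M ≤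
      ENNReal.ofReal C := by
    calc _ ≤ ∫⁻ x, liminf (fun k => ENNReal.ofReal
          (expRem (m + 1) (u k * F x) / u k ^ (m + 1))) atTop ∂M := by
          refine lintegral_mono fun x => le_of_eq ?_
          exact ((ENNReal.tendsto_ofReal ((hpt x).comp hut)).liminf_eq).symm
      _ ≤ liminf (fun k => ∫⁻ x, ENNReal.ofReal
          (expRem (m + 1) (u k * F x) / u k ^ (m + 1)) ∂M) atTop := by
          refine lintegral_liminf_le fun k => ?_
          exact ((((continuous_expRem _).measurable.comp (hF.const_mul _)).div_const _)).ennreal_ofReal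
      _ ≤ _ := by
          refine liminf_le_of_le (by isBoundedDefault) fun b hb => ?_
          obtain ⟨k, hk⟩ := hb.exists
          refine hk.trans ?_
          rw [← ofReal_integral_eq_lintegral_ofReal]
          · exact ENNReal.ofReal_le_ofReal (hbound _ (hu0 k).1 (hu0 k).2)
          · exact (integral_exp_neg_mul_eq hF hF0 hm (hu0 k).1.le).1.div_const _
          · refine Eventually.of_forall fun x => div_nonneg (expRem_nonneg _ ?_) ?_
            · exact mul_nonneg (hu0 k).1.le (hF0 x)
            · exact pow_nonneg (hu0 k).1.le _
  have hint : Integrable (fun x => F x ^ (m + 1) / ((m + 1).factorial : ℝ)) M := by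
    refine ⟨((hF.pow_const _).div_const _).aestronglyMeasurable, ?_⟩
    rw [hasFiniteIntegral_iff_ofReal (Eventually.of_forall fun x => by
      have := hF0 x; positivity)]
    exact hfin.trans_lt ENNReal.ofReal_lt_top
  refine (hint.mul_const ((m + 1).factorial : ℝ)).congr (Eventually.of_forall fun x => ?_)
  have : ((m + 1).factorial : ℝ) ≠ 0 := by positivity
  simp only
  field_simp

end Laplace

/-! ### The heat semigroup as a Fourier multiplier. -/

variable {n : ℕ}

theorem mulOp_ae (g : Linf n) (f : L2 n) : mulOp g f =ᵐ[volume] fun x => g x * f x :=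
  (ContinuousLinearMap.mul ℂ ℂ).coeFn_holder g f

theorem norm_mulOp_le (g : Linf n) : ‖mulOp g‖ ≤ ‖g‖ := by
  refine ((ContinuousLinearMap.mul ℂ ℂ).holderL volume ∞ 2 2).le_opNorm g |>.trans ?_
  have h1 : ‖(ContinuousLinearMap.mul ℂ ℂ).holderL
      (volume : Measure (EuclideanSpace ℝ (Fin n))) ∞ 2 2‖ ≤ 1 :=
    (ContinuousLinearMap.norm_holderL_le _).trans (ContinuousLinearMap.opNorm_mul_le ℂ ℂ)
  exact mul_le_of_le_one_left (norm_nonneg _) h1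

theorem mulOp_sub (g h : Linf n) : mulOp (g - h) = mulOp g - mulOp h :=
  map_sub ((ContinuousLinearMap.mul ℂ ℂ).holderL volume ∞ 2 2) g h

theorem norm_toLp_top_le {g : EuclideanSpace ℝ (Fin n) → ℂ} (hg : MemLp g ∞ volume) {C : ℝ}
    (hC : 0 ≤ C) (h : ∀ᵐ x, ‖g x‖ ≤ C) : ‖(hg.toLp : Linf n)‖ ≤ C := by
  rw [Lp.norm_toLp]
  refine ENNReal.toReal_le_of_le_ofReal hC ?_
  rw [eLpNorm_exponent_top]
  exact eLpNormEssSup_le_of_ae_bound h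

theorem heatSymbol_of_nonneg {s : ℝ} (hs : 0 ≤ s) (ξ : EuclideanSpace ℝ (Fin n)) :
    heatSymbol s ξ = ((Real.exp (-(s * (2 * Real.pi * ‖ξ‖) ^ 2)) : ℝ) : ℂ) := by
  rw [heatSymbol, max_eq_left hs]

theorem heatOp_apply (s : ℝ) (f : L2 n) :
    heatOp s f = 𝓕⁻ (mulOp (memLp_heatSymbol s).toLp (𝓕 f : L2 n)) := rfl

theorem fourier_heatOp (s : ℝ) (f : L2 n) :
    𝓕 (heatOp s f) = mulOp (memLp_heatSymbol s).toLp (𝓕 f : L2 n) := by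
  rw [heatOp_apply, FourierTransform.fourier_fourierInv_eq]

theorem fourier_heatOp_ae (s : ℝ) (f : L2 n) :
    (𝓕 (heatOp s f) : L2 n) =ᵐ[volume] fun ξ => heatSymbol s ξ * (𝓕 f : L2 n) ξ := by
  rw [fourier_heatOp]
  filter_upwards [mulOp_ae (memLp_heatSymbol s).toLp (𝓕 f : L2 n),
    (memLp_heatSymbol (n := n) s).coeFn_toLp] with ξ h1 h2
  rw [h1, h2]

theorem fourier_injective_L2 {f g : L2 n} (h : (𝓕 f : L2 n) = 𝓕 g) : f = g :=
  (Lp.fourierTransformₗᵢ (EuclideanSpace ℝ (Fin n)) ℂ).injective h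

theorem heatOp_comp {s s' : ℝ} (hs : 0 ≤ s) (hs' : 0 ≤ s') :
    heatOp (n := n) s ∘L heatOp s' = heatOp (s + s') := by
  ext1 f
  refine fourier_injective_L2 (Lp.ext ?_)
  rw [ContinuousLinearMap.comp_apply]
  filter_upwards [fourier_heatOp_ae s (heatOp s' f), fourier_heatOp_ae s' f,
    fourier_heatOp_ae (s + s') f] with ξ h1 h2 h3
  rw [h1, h2, h3, heatSymbol_of_nonneg hs, heatSymbol_of_nonneg hs',
    heatSymbol_of_nonneg (add_nonneg hs hs'), ← mul_assoc, ← Complex.ofReal_mul, ← Real.exp_add]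
  congr 4
  ring

theorem inner_heatOp_left (s : ℝ) (f g : L2 n) :
    inner ℂ (heatOp s f) g = inner ℂ f (heatOp s g) := by
  rw [← Lp.inner_fourier_eq, ← Lp.inner_fourier_eq f, L2.inner_def, L2.inner_def]
  refine integral_congr_ae ?_
  filter_upwards [fourier_heatOp_ae s f, fourier_heatOp_ae s g] with ξ h1 h2
  rw [h1, h2]
  simp only [heatSymbol, RCLike.inner_apply, map_mul, Complex.conj_ofReal]
  ring

theorem norm_heatOp_le_of_mulOp (T : L2 n →L[ℂ] L2 n) (g : Linf n)
    (h : ∀ f, T f = 𝓕⁻ (mulOp g (𝓕 f : L2 n))) : ‖T‖ ≤ ‖g‖ := by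
  refine ContinuousLinearMap.opNorm_le_bound _ (norm_nonneg _) fun f => ?_
  rw [h]
  have : ‖(𝓕⁻ (mulOp g (𝓕 f : L2 n)) : L2 n)‖ = ‖mulOp g (𝓕 f : L2 n)‖ :=
    (Lp.fourierTransformₗᵢ (EuclideanSpace ℝ (Fin n)) ℂ).symm.norm_map _
  rw [this]
  refine ((mulOp g).le_opNorm _).trans ?_
  rw [Lp.norm_fourier_eq]
  exact mul_le_mul_of_nonneg_right (norm_mulOp_le g) (norm_nonneg _)

theorem norm_heatSymbol_le_one (s : ℝ) (ξ : EuclideanSpace ℝ (Fin n)) :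
    ‖heatSymbol s ξ‖ ≤ 1 := by
  rw [heatSymbol, Complex.norm_real, Real.norm_of_nonneg (Real.exp_pos _).le,
      Real.exp_le_one_iff, neg_nonpos]
  positivity

theorem norm_heatOp_le_one (s : ℝ) : ‖heatOp (n := n) s‖ ≤ 1 :=
  (norm_heatOp_le_of_mulOp _ _ (heatOp_apply s)).trans
    (norm_toLp_top_le _ zero_le_one (Eventually.of_forall fun ξ => norm_heatSymbol_le_one s ξ))

/-- The estimate is uniform in `x` because `exp (-(s * x)) * (δ * x) ≤ 1`. It gives operator-norm
continuity of the heat semigroup away from time `0`. -/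
theorem abs_exp_neg_mul_sub_le {δ s s' x : ℝ} (hδ : 0 < δ) (hs : δ ≤ s) (hs' : δ ≤ s')
    (hx : 0 ≤ x) : |Real.exp (-(s * x)) - Real.exp (-(s' * x))| ≤ |s - s'| / δ := by
  wlog h : s ≤ s' generalizing s s'
  · rw [abs_sub_comm, abs_sub_comm s]
    exact this hs' hs (le_of_not_ge h)
  have h1 : Real.exp (-(s' * x)) = Real.exp (-(s * x)) * Real.exp (-((s' - s) * x)) := by
    rw [← Real.exp_add]; congr 1; ring
  have h2 : 1 - (s' - s) * x ≤ Real.exp (-((s' - s) * x)) := by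
    have := Real.add_one_le_exp (-((s' - s) * x)); linarith
  have h3 : Real.exp (-((s' - s) * x)) ≤ 1 := by
    rw [Real.exp_le_one_iff, neg_nonpos]; exact mul_nonneg (by linarith) hx
  have h4 : Real.exp (-(s * x)) * (δ * x) ≤ 1 := by
    have h5 : δ * x ≤ Real.exp (s * x) := by
      have := Real.add_one_le_exp (s * x)
      have := mul_le_mul_of_nonneg_right hs hx
      linarith
    calc _ ≤ Real.exp (-(s * x)) * Real.exp (s * x) :=
          mul_le_mul_of_nonneg_left h5 (Real.exp_pos _).le
      _ = 1 := by rw [← Real.exp_add]; simp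
  have hpos := Real.exp_pos (-(s * x))
  rw [h1, abs_sub_comm s, abs_of_nonneg (by linarith : 0 ≤ s' - s), le_div_iff₀ hδ,
    abs_of_nonneg (by nlinarith)]
  calc (Real.exp (-(s * x)) - Real.exp (-(s * x)) * Real.exp (-((s' - s) * x))) * δ
      = Real.exp (-(s * x)) * (1 - Real.exp (-((s' - s) * x))) * δ := by ring
    _ ≤ Real.exp (-(s * x)) * ((s' - s) * x) * δ := by
        gcongr; linarith
    _ = (s' - s) * (Real.exp (-(s * x)) * (δ * x)) := by ring
    _ ≤ (s' - s) * 1 := mul_le_mul_of_nonneg_left h4 (by linarith)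
    _ = s' - s := mul_one _

theorem norm_heatOp_sub_le {δ s s' : ℝ} (hδ : 0 < δ) (hs : δ ≤ s) (hs' : δ ≤ s') :
    ‖heatOp (n := n) s - heatOp s'‖ ≤ |s - s'| / δ := by
  refine (norm_heatOp_le_of_mulOp _
    ((memLp_heatSymbol s).sub (memLp_heatSymbol s')).toLp fun f => ?_).trans
    (norm_toLp_top_le _ (by positivity) (Eventually.of_forall fun ξ => ?_))
  · rw [MemLp.toLp_sub, mulOp_sub, sub_apply, sub_apply, heatOp_apply, heatOp_apply]
    exact (map_sub (Lp.fourierTransformₗᵢ (EuclideanSpace ℝ (Fin n)) ℂ).symm _ _).symm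
  · rw [Pi.sub_apply, heatSymbol_of_nonneg (hδ.le.trans hs), heatSymbol_of_nonneg (hδ.le.trans hs'),
      ← Complex.ofReal_sub, Complex.norm_real, Real.norm_eq_abs]
    exact abs_exp_neg_mul_sub_le hδ hs hs' (sq_nonneg _)

theorem continuousOn_heatOp : ContinuousOn (heatOp (n := n)) (Set.Ioi 0) := by
  intro s hs
  have hs : 0 < s := hs
  refine ContinuousAt.continuousWithinAt ?_
  rw [ContinuousAt, tendsto_iff_norm_sub_tendsto_zero]
  have h1 : Tendsto (fun s' : ℝ => |s' - s| / (s / 2)) (𝓝 s) (𝓝 0) := by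
    have : Continuous fun s' : ℝ => |s' - s| / (s / 2) := by fun_prop
    simpa using this.tendsto s
  refine squeeze_zero' (Eventually.of_forall fun _ => norm_nonneg _) ?_ h1
  filter_upwards [lt_mem_nhds (half_lt_self hs)] with s' hs'
  exact norm_heatOp_sub_le (half_pos hs) hs'.le (half_le_self hs.le)

/-! ### The heat kernel and its vectors in `L²`. -/

section Kernel

/-- On `L¹ ∩ L²` the inverse Fourier transform on `L²` is given by the Fourier integral. -/
theorem fourierInv_L2_ae (g : L2 n) (hg : Integrable g) :
    (𝓕⁻ g : L2 n) =ᵐ[volume] 𝓕⁻ (g : EuclideanSpace ℝ (Fin n) → ℂ) := by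
  have hcont : Continuous (𝓕⁻ (g : EuclideanSpace ℝ (Fin n) → ℂ)) := by
    have := (Real.Lp.fourierTransformInv (memLp_one_iff_integrable.2 hg).toLp).continuous
    rwa [Real.Lp.fourierTransformInv_toLp] at this
  -- Test both functions against smooth compactly supported `φ`. The `L²` transform is the
  -- distributional one, and self-adjointness of the Fourier integral moves it from the test
  -- function to `g`.
  refine ae_eq_of_integral_contDiff_smul_eq ((Lp.memLp _).locallyIntegrable one_le_two)
    hcont.locallyIntegrable fun φ hφ hφc => ?_
  have h1 : HasCompactSupport (Complex.ofRealCLM ∘ φ) := hφc.comp_left rfl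
  have h2 : ContDiff ℝ ((⊤ : ℕ∞) : WithTop ℕ∞) (Complex.ofRealCLM ∘ φ) := by fun_prop
  set ψ : 𝓢(EuclideanSpace ℝ (Fin n), ℂ) := h1.toSchwartzMap h2 with hψ
  have h3 : ∀ x, ψ x = (φ x : ℂ) := fun x => rfl
  have h4 := congrArg (fun T : 𝓢'(EuclideanSpace ℝ (Fin n), ℂ) => T ψ)
    (Lp.fourierInv_toTemperedDistribution_eq g)
  simp only [TemperedDistribution.fourierInv_apply, Lp.toTemperedDistribution_apply] at h4
  have h5 : ∀ f : EuclideanSpace ℝ (Fin n) → ℂ, ∫ x, φ x • f x = ∫ x, ψ x • f x := fun f => by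
    simp [h3]
  rw [h5, h5, ← h4]
  have h6 := VectorFourier.integral_fourierIntegral_smul_eq_flip
    (μ := (volume : Measure (EuclideanSpace ℝ (Fin n))))
    (ν := (volume : Measure (EuclideanSpace ℝ (Fin n)))) (L := -innerₗ _)
    (f := ψ) (g := g) (e := Real.fourierChar) Real.continuous_fourierChar
    (continuous_inner (𝕜 := ℝ) (E := EuclideanSpace ℝ (Fin n))).neg
    (ψ.integrable) hg
  rw [SchwartzMap.fourierInv_coe]
  refine h6.trans ?_
  congr with x
  congr 1
  simp only [VectorFourier.fourierIntegral, Real.fourierInv_eq]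
  congr with y
  simp [real_inner_comm]

/-- The heat kernel at time `s`. -/
def heatKer (s : ℝ) (x : EuclideanSpace ℝ (Fin n)) : ℝ :=
  (4 * Real.pi * s) ^ (-(n : ℝ) / 2) * Real.exp (-(‖x‖ ^ 2 / (4 * s)))

theorem heatKer_nonneg {s : ℝ} (hs : 0 < s) (x : EuclideanSpace ℝ (Fin n)) : 0 ≤ heatKer s x := by
  unfold heatKer; positivity

theorem heatKer_neg (s : ℝ) (x : EuclideanSpace ℝ (Fin n)) : heatKer s (-x) = heatKer s x := by
  rw [heatKer, heatKer, norm_neg]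

@[fun_prop]
theorem continuous_heatKer (s : ℝ) : Continuous (heatKer (n := n) s) := by
  unfold heatKer; fun_prop

theorem heatKer_le {s : ℝ} (hs : 0 < s) (x : EuclideanSpace ℝ (Fin n)) :
    heatKer s x ≤ (4 * Real.pi * s) ^ (-(n : ℝ) / 2) := by
  refine mul_le_of_le_one_right (by positivity) ?_
  rw [Real.exp_le_one_iff, neg_nonpos]
  positivity

/-- Since `1/a + 1/b = (a + b)/(ab)`, the exponents combine into that of time `ab/(a + b)`. With `a
+ b = t`, the leftover normalization is the factor `(4πt)^{-n/2}` of the theorem. -/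
theorem heatKer_mul_heatKer {a b : ℝ} (ha : 0 < a) (hb : 0 < b) (x : EuclideanSpace ℝ (Fin n)) :
    heatKer a x * heatKer b x =
      (4 * Real.pi * (a + b)) ^ (-(n : ℝ) / 2) * heatKer (a * b / (a + b)) x := by
  unfold heatKer
  rw [mul_mul_mul_comm, ← Real.exp_add, ← mul_assoc, ← Real.mul_rpow (by positivity) (by positivity),
    ← Real.mul_rpow (by positivity) (by positivity)]
  congr 2
  · field_simp
  · field_simp
    ring

theorem integrable_exp_neg_mul_norm_sq {c : ℝ} (hc : 0 < c) :
    Integrable (fun x : EuclideanSpace ℝ (Fin n) => Real.exp (-(c * ‖x‖ ^ 2))) := by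
  have h := (GaussianFourier.integrable_cexp_neg_mul_sq_norm_add (b := (c : ℂ))
    (V := EuclideanSpace ℝ (Fin n)) (by simpa using hc) 0 0).norm
  refine h.congr (Eventually.of_forall fun x => ?_)
  simp only [Complex.norm_exp]
  congr 1
  simp [← Complex.ofReal_pow]

/-- The heat symbol times the character `exp (-2πi ⟨x, ξ⟩)`. -/
def modSymbol (s : ℝ) (x ξ : EuclideanSpace ℝ (Fin n)) : ℂ :=
  Complex.exp (-((4 * Real.pi ^ 2 * s : ℝ) : ℂ) * (‖ξ‖ : ℂ) ^ 2 +
    2 * Real.pi * Complex.I * (inner ℝ (-x) ξ : ℝ))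

@[fun_prop]
theorem continuous_modSymbol (s : ℝ) (x : EuclideanSpace ℝ (Fin n)) :
    Continuous (modSymbol s x) := by
  unfold modSymbol; fun_prop

theorem norm_modSymbol (s : ℝ) (x ξ : EuclideanSpace ℝ (Fin n)) :
    ‖modSymbol s x ξ‖ = Real.exp (-(4 * Real.pi ^ 2 * s * ‖ξ‖ ^ 2)) := by
  rw [modSymbol, Complex.norm_exp]
  congr 1
  simp [← Complex.ofReal_pow]

theorem integrable_modSymbol {s : ℝ} (hs : 0 < s) (x : EuclideanSpace ℝ (Fin n)) :
    Integrable (modSymbol s x) := by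
  refine (integrable_exp_neg_mul_norm_sq (c := 4 * Real.pi ^ 2 * s) (by positivity)).mono'
    (continuous_modSymbol s x).aestronglyMeasurable (Eventually.of_forall fun ξ => ?_)
  rw [norm_modSymbol]

theorem memLp_modSymbol {s : ℝ} (hs : 0 < s) (x : EuclideanSpace ℝ (Fin n)) :
    MemLp (modSymbol s x) 2 volume := by
  rw [memLp_two_iff_integrable_sq_norm (continuous_modSymbol s x).aestronglyMeasurable]
  refine (integrable_exp_neg_mul_norm_sq (c := 4 * Real.pi ^ 2 * (2 * s)) (by positivity)).congr
    (Eventually.of_forall fun ξ => ?_)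
  simp only
  rw [norm_modSymbol, ← Real.exp_nat_mul]
  congr 1
  push_cast
  ring

theorem fourierInv_modSymbol {s : ℝ} (hs : 0 < s) (x y : EuclideanSpace ℝ (Fin n)) :
    𝓕⁻ (modSymbol s x) y = (heatKer s (x - y) : ℂ) := by
  have hb : 0 < (((4 * Real.pi ^ 2 * s : ℝ) : ℂ)).re := by
    rw [Complex.ofReal_re]; positivity
  rw [Real.fourierInv_eq_fourier_neg]
  refine (fourier_gaussian_innerProductSpace' hb (-x) (-y)).trans ?_
  have h1 : (Real.pi : ℂ) / ((4 * Real.pi ^ 2 * s : ℝ) : ℂ) = (((4 * Real.pi * s)⁻¹ : ℝ) : ℂ) := by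
    rw [← Complex.ofReal_div]
    congr 1
    field_simp
  have h2 : -(Real.pi : ℂ) ^ 2 * (‖-x - -y‖ : ℂ) ^ 2 / ((4 * Real.pi ^ 2 * s : ℝ) : ℂ) =
      ((-(‖x - y‖ ^ 2 / (4 * s)) : ℝ) : ℂ) := by
    rw [neg_sub_neg, norm_sub_rev]
    norm_cast
    field_simp
  rw [h1, h2, heatKer, Complex.ofReal_mul, Complex.ofReal_exp]
  congr 1
  rw [finrank_euclideanSpace_fin, neg_div, Real.rpow_neg (by positivity),
    ← Real.inv_rpow (by positivity), Complex.ofReal_cpow (by positivity)]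
  push_cast
  rfl

theorem heatSymbol_mul_char {s : ℝ} (hs : 0 ≤ s) (x ξ : EuclideanSpace ℝ (Fin n)) :
    starRingEnd ℂ (modSymbol s x ξ) =
      Real.fourierChar (inner ℝ ξ x) * heatSymbol s ξ := by
  rw [heatSymbol_of_nonneg hs, modSymbol, ← Complex.exp_conj, Real.fourierChar_apply,
    Complex.ofReal_exp, ← Complex.exp_add]
  congr 1
  simp only [map_add, map_mul, map_neg, Complex.conj_ofReal, Complex.conj_I, map_pow, map_ofNat,
    inner_neg_left, real_inner_comm ξ x]
  push_cast
  ring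

theorem memLp_heatKer {s : ℝ} (hs : 0 < s) (x : EuclideanSpace ℝ (Fin n)) :
    MemLp (fun y => (heatKer s (x - y) : ℂ)) 2 volume := by
  have h := Lp.memLp (𝓕⁻ ((memLp_modSymbol hs x).toLp : L2 n) : L2 n)
  refine h.ae_eq ?_
  have hi : Integrable ((memLp_modSymbol hs x).toLp : L2 n) :=
    (integrable_modSymbol hs x).congr (memLp_modSymbol hs x).coeFn_toLp.symm
  filter_upwards [fourierInv_L2_ae _ hi] with y hy
  rw [hy, Real.fourierInv_congr_ae (memLp_modSymbol hs x).coeFn_toLp, fourierInv_modSymbol hs]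

/-- The heat kernel `p_s(x - ·)` as a vector in `L²`; by convention `0` for `s ≤ 0`. -/
def kerVec (s : ℝ) (x : EuclideanSpace ℝ (Fin n)) : L2 n :=
  if hs : 0 < s then (memLp_heatKer hs x).toLp else 0

theorem kerVec_ae {s : ℝ} (hs : 0 < s) (x : EuclideanSpace ℝ (Fin n)) :
    kerVec s x =ᵐ[volume] fun y => (heatKer s (x - y) : ℂ) := by
  rw [kerVec, dif_pos hs]
  exact MemLp.coeFn_toLp _

theorem fourierInv_toLp_modSymbol {s : ℝ} (hs : 0 < s) (x : EuclideanSpace ℝ (Fin n)) :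
    (𝓕⁻ ((memLp_modSymbol hs x).toLp : L2 n) : L2 n) = kerVec s x := by
  refine Lp.ext ?_
  have hi : Integrable ((memLp_modSymbol hs x).toLp : L2 n) :=
    (integrable_modSymbol hs x).congr (memLp_modSymbol hs x).coeFn_toLp.symm
  filter_upwards [fourierInv_L2_ae _ hi, kerVec_ae hs x] with y hy hk
  rw [hy, hk, Real.fourierInv_congr_ae (memLp_modSymbol hs x).coeFn_toLp, fourierInv_modSymbol hs]

theorem fourier_kerVec {s : ℝ} (hs : 0 < s) (x : EuclideanSpace ℝ (Fin n)) :
    (𝓕 (kerVec s x) : L2 n) = (memLp_modSymbol hs x).toLp := by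
  rw [← fourierInv_toLp_modSymbol hs, FourierTransform.fourier_fourierInv_eq]

/-- The semigroup law `p_s * p_s = p_{2s}`, read off from Plancherel by multiplying symbols. -/
theorem inner_kerVec_kerVec {s : ℝ} (hs : 0 < s) (x y : EuclideanSpace ℝ (Fin n)) :
    inner ℂ (kerVec s x) (kerVec s y) = (heatKer (2 * s) (x - y) : ℂ) := by
  rw [← Lp.inner_fourier_eq, fourier_kerVec hs, fourier_kerVec hs, L2.inner_def,
    ← neg_sub, heatKer_neg, ← fourierInv_modSymbol (by positivity), Real.fourierInv_eq]
  refine integral_congr_ae ?_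
  filter_upwards [(memLp_modSymbol hs x).coeFn_toLp, (memLp_modSymbol hs y).coeFn_toLp]
    with ξ h1 h2
  rw [h1, h2, RCLike.inner_apply, heatSymbol_mul_char hs.le, Circle.smul_def, smul_eq_mul,
    mul_left_comm, mul_comm (modSymbol s y ξ)]
  congr 1
  rw [heatSymbol_of_nonneg hs.le, modSymbol, modSymbol, Complex.ofReal_exp, ← Complex.exp_add]
  congr 1
  push_cast
  ring

theorem norm_kerVec_sq {s : ℝ} (hs : 0 < s) (x : EuclideanSpace ℝ (Fin n)) :
    ‖kerVec s x‖ ^ 2 = heatKer (2 * s) (0 : EuclideanSpace ℝ (Fin n)) := by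
  have h := inner_kerVec_kerVec hs x x
  rw [inner_self_eq_norm_sq_to_K, sub_self] at h
  apply Complex.ofReal_injective
  rw [← h, Complex.ofReal_pow]
  rfl

theorem continuous_kerVec {s : ℝ} (hs : 0 < s) : Continuous (kerVec (n := n) s) := by
  rw [continuous_iff_continuousAt]
  intro x
  rw [ContinuousAt, tendsto_iff_norm_sub_tendsto_zero]
  have h1 : ∀ y, ‖kerVec s y - kerVec s x‖ =
      Real.sqrt (2 * heatKer (2 * s) (0 : EuclideanSpace ℝ (Fin n)) -
        2 * heatKer (2 * s) (y - x)) := by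
    intro y
    rw [← Real.sqrt_sq (norm_nonneg (kerVec s y - kerVec s x)), norm_sub_sq (𝕜 := ℂ),
      inner_kerVec_kerVec hs, norm_kerVec_sq hs, norm_kerVec_sq hs]
    have hre : RCLike.re (heatKer (2 * s) (y - x) : ℂ) = heatKer (2 * s) (y - x) :=
      Complex.ofReal_re _
    rw [hre]
    congr 1
    ring
  simp_rw [h1]
  have : Continuous fun y => Real.sqrt (2 * heatKer (2 * s) (0 : EuclideanSpace ℝ (Fin n)) -
        2 * heatKer (2 * s) (y - x)) := by fun_prop
  simpa using this.tendsto x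

/-- The multiplied transform is a product of two `L²` functions, hence integrable, so the inverse
transform is an honest integral; Plancherel turns it into a pairing with the kernel vector. -/
theorem heatOp_ae {s : ℝ} (hs : 0 < s) (f : L2 n) :
    heatOp s f =ᵐ[volume] fun x => inner ℂ (kerVec s x) f := by
  set g : L2 n := mulOp (memLp_heatSymbol s).toLp (𝓕 f : L2 n) with hg
  have hgae : ∀ x : EuclideanSpace ℝ (Fin n), (fun ξ : EuclideanSpace ℝ (Fin n) =>
      starRingEnd ℂ (((memLp_modSymbol hs x).toLp : L2 n) ξ) * (𝓕 f : L2 n) ξ)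
      =ᵐ[volume] fun ξ => Real.fourierChar (inner ℝ ξ x) • g ξ := by
    intro x
    filter_upwards [mulOp_ae (memLp_heatSymbol s).toLp (𝓕 f : L2 n),
      (memLp_heatSymbol (n := n) s).coeFn_toLp, (memLp_modSymbol hs x).coeFn_toLp] with ξ h1 h2 h3
    rw [hg, h1, h2, h3, heatSymbol_mul_char hs.le, Circle.smul_def, smul_eq_mul, mul_assoc]
  have hgi : Integrable g := by
    have h1 := L2.integrable_inner (𝕜 := ℂ) (memLp_modSymbol hs 0).toLp (𝓕 f : L2 n)
    refine h1.congr ?_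
    filter_upwards [hgae 0] with ξ h2
    rw [RCLike.inner_apply, mul_comm, h2]
    simp
  rw [heatOp_apply]
  filter_upwards [fourierInv_L2_ae g hgi] with x hx
  rw [hx, Real.fourierInv_eq, ← Lp.inner_fourier_eq, fourier_kerVec hs, L2.inner_def]
  refine integral_congr_ae ?_
  filter_upwards [hgae x] with ξ hξ
  rw [← hξ, RCLike.inner_apply, mul_comm]

end Kernel

/-! ### Trace norms and traces of integrals of operators. -/

section TraceClass

variable {H : Type*} [NormedAddCommGroup H] [InnerProductSpace ℂ H]

/-- The trace norm of `T` is at most `K`. -/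
def TraceNormLE (T : H →L[ℂ] H) (K : ℝ) : Prop :=
  ∀ (ι : Type) (s : Finset ι) (e f : ι → H), Orthonormal ℂ e → Orthonormal ℂ f →
    ∑ i ∈ s, ‖inner ℂ (f i) (T (e i))‖ ≤ K

theorem TraceNormLE.isTraceClass {T : H →L[ℂ] H} {K : ℝ} (h : TraceNormLE T K) :
    IsTraceClass T :=
  ⟨K, fun N e f he hf => h (Fin N) Finset.univ e f he hf⟩

/-- Distinct orthonormal vectors are at distance `√2`, so the balls of radius `1/2` are disjoint.
Countability is what allows the sum over a basis to be exchanged with integrals. -/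
theorem countable_of_orthonormal [TopologicalSpace.SeparableSpace H] {ι : Type*} {e : ι → H}
    (he : Orthonormal ℂ e) : Countable ι := by
  refine Pairwise.countable_of_isOpen_disjoint (s := fun i => Metric.ball (e i) (1 / 2)) ?_
    (fun i => Metric.isOpen_ball) fun i => ⟨e i, Metric.mem_ball_self (by norm_num)⟩
  intro i j hij
  refine Metric.ball_disjoint_ball ?_
  have h : ‖e i - e j‖ ^ 2 = 2 := by
    rw [norm_sub_sq (𝕜 := ℂ), he.1, he.1, he.2 hij]
    norm_num
  rw [dist_eq_norm]
  nlinarith [norm_nonneg (e i - e j)]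

/-- Cauchy–Schwarz followed by Bessel for each system: the trace norm of a rank-one operator. -/
theorem sum_norm_inner_mul_inner_le {ι : Type*} (s : Finset ι) {e f : ι → H}
    (he : Orthonormal ℂ e) (hf : Orthonormal ℂ f) (u v : H) :
    ∑ i ∈ s, ‖inner ℂ (f i) u * inner ℂ v (e i)‖ ≤ ‖u‖ * ‖v‖ := by
  simp_rw [norm_mul]
  refine (Real.sum_mul_le_sqrt_mul_sqrt s _ _).trans ?_
  have h1 : ∑ i ∈ s, ‖inner ℂ (f i) u‖ ^ 2 ≤ ‖u‖ ^ 2 := hf.sum_inner_products_le u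
  have h2 : ∑ i ∈ s, ‖inner ℂ v (e i)‖ ^ 2 ≤ ‖v‖ ^ 2 := by
    simp_rw [norm_inner_symm v]
    exact he.sum_inner_products_le v
  exact mul_le_mul (Real.sqrt_le_iff.2 ⟨norm_nonneg _, h1⟩) (Real.sqrt_le_iff.2 ⟨norm_nonneg _, h2⟩)
    (Real.sqrt_nonneg _) (norm_nonneg _)

section RankOne

variable {Z : Type*} [MeasurableSpace Z] {μ : Measure Z} {u v : Z → H} {T : H →L[ℂ] H}

theorem integrable_inner_mul_inner (hu : AEStronglyMeasurable u μ) (hv : AEStronglyMeasurable v μ)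
    (huv : Integrable (fun z => ‖u z‖ * ‖v z‖) μ) (f e : H) :
    Integrable (fun z => inner ℂ f (u z) * inner ℂ (v z) e) μ := by
  refine (huv.const_mul (‖f‖ * ‖e‖)).mono'
    ((aestronglyMeasurable_const.inner hu).mul (hv.inner aestronglyMeasurable_const))
    (Eventually.of_forall fun z => ?_)
  rw [norm_mul]
  calc _ ≤ (‖f‖ * ‖u z‖) * (‖v z‖ * ‖e‖) :=
        mul_le_mul (norm_inner_le_norm _ _) (norm_inner_le_norm _ _) (norm_nonneg _) (by positivity)
    _ = _ := by ring

theorem sum_integral_norm_le (hu : AEStronglyMeasurable u μ) (hv : AEStronglyMeasurable v μ)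
    (huv : Integrable (fun z => ‖u z‖ * ‖v z‖) μ) {ι : Type*} (s : Finset ι) {e f : ι → H}
    (he : Orthonormal ℂ e) (hf : Orthonormal ℂ f) :
    ∑ i ∈ s, ∫ z, ‖inner ℂ (f i) (u z) * inner ℂ (v z) (e i)‖ ∂μ ≤ ∫ z, ‖u z‖ * ‖v z‖ ∂μ := by
  rw [← integral_finsetSum _ fun i _ => (integrable_inner_mul_inner hu hv huv (f i) (e i)).norm]
  exact integral_mono (integrable_finsetSum _ fun i _ =>
    (integrable_inner_mul_inner hu hv huv (f i) (e i)).norm) huv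
    fun z => sum_norm_inner_mul_inner_le s he hf (u z) (v z)

theorem traceNormLE_of_rankOne (hu : AEStronglyMeasurable u μ) (hv : AEStronglyMeasurable v μ)
    (huv : Integrable (fun z => ‖u z‖ * ‖v z‖) μ)
    (hT : ∀ f e, inner ℂ f (T e) = ∫ z, inner ℂ f (u z) * inner ℂ (v z) e ∂μ) :
    TraceNormLE T (∫ z, ‖u z‖ * ‖v z‖ ∂μ) := by
  intro ι s e f he hf
  refine (Finset.sum_le_sum fun i _ => ?_).trans (sum_integral_norm_le hu hv huv s he hf)
  rw [hT]
  exact norm_integral_le_integral_norm _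

/-- The Bessel bound gives absolute summability, so sum and integral may be exchanged; under the
integral the sum is Parseval's identity. -/
theorem hasSum_trace_of_rankOne [TopologicalSpace.SeparableSpace H]
    (hu : AEStronglyMeasurable u μ) (hv : AEStronglyMeasurable v μ)
    (huv : Integrable (fun z => ‖u z‖ * ‖v z‖) μ)
    (hT : ∀ f e, inner ℂ f (T e) = ∫ z, inner ℂ f (u z) * inner ℂ (v z) e ∂μ)
    {ι : Type*} (b : HilbertBasis ι ℂ H) :
    HasSum (fun i => inner ℂ (b i) (T (b i))) (∫ z, inner ℂ (v z) (u z) ∂μ) := by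
  have := countable_of_orthonormal b.orthonormal
  have h1 : Summable fun i => ∫ z, ‖inner ℂ (b i) (u z) * inner ℂ (v z) (b i)‖ ∂μ :=
    summable_of_sum_le (fun i => integral_nonneg fun z => norm_nonneg _)
      fun s => sum_integral_norm_le hu hv huv s b.orthonormal b.orthonormal
  have h2 := hasSum_integral_of_summable_integral_norm
    (fun i => integrable_inner_mul_inner hu hv huv (b i) (b i)) h1
  simp_rw [hT]
  have h3 : ∫ z, inner ℂ (v z) (u z) ∂μ =
      ∫ z, ∑' i, inner ℂ (b i) (u z) * inner ℂ (v z) (b i) ∂μ := by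
    refine integral_congr_ae (Eventually.of_forall fun z => ?_)
    simp only
    rw [← b.tsum_inner_mul_inner (v z) (u z)]
    exact tsum_congr fun i => mul_comm _ _
  rw [h3]
  exact h2

end RankOne

section BochnerIntegral

variable [CompleteSpace H] {S : Type*} [MeasurableSpace S] {ν : Measure S} [IsFiniteMeasure ν]
  {T : S → H →L[ℂ] H} {K : ℝ}

omit [IsFiniteMeasure ν] in
theorem inner_integral_apply (hT : Integrable T ν) (f e : H) :
    inner ℂ f ((∫ s, T s ∂ν) e) = ∫ s, inner ℂ f (T s e) ∂ν := by
  rw [ContinuousLinearMap.integral_apply hT, ← integral_inner (hT.apply_continuousLinearMap e)]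

omit [CompleteSpace H] [IsFiniteMeasure ν] in
theorem integrable_inner_apply (hT : Integrable T ν) (f e : H) :
    Integrable (fun s => inner ℂ f (T s e)) ν :=
  (hT.apply_continuousLinearMap e).const_inner f

omit [CompleteSpace H] in
theorem sum_integral_norm_inner_le (hT : Integrable T ν) (hK : ∀ᵐ s ∂ν, TraceNormLE (T s) K)
    {ι : Type} (s : Finset ι) {e f : ι → H} (he : Orthonormal ℂ e) (hf : Orthonormal ℂ f) :
    ∑ i ∈ s, ∫ x, ‖inner ℂ (f i) (T x (e i))‖ ∂ν ≤ K * ν.real Set.univ := by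
  rw [← integral_finsetSum _ fun i _ => (integrable_inner_apply hT (f i) (e i)).norm]
  refine (integral_mono_ae (integrable_finsetSum _ fun i _ =>
    (integrable_inner_apply hT (f i) (e i)).norm) (integrable_const K) ?_).trans ?_
  · filter_upwards [hK] with x hx using hx ι s e f he hf
  · rw [integral_const, smul_eq_mul, mul_comm]

theorem traceNormLE_integral (hT : Integrable T ν) (hK : ∀ᵐ s ∂ν, TraceNormLE (T s) K) :
    TraceNormLE (∫ s, T s ∂ν) (K * ν.real Set.univ) := by
  intro ι s e f he hf
  refine (Finset.sum_le_sum fun i _ => ?_).trans (sum_integral_norm_inner_le hT hK s he hf)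
  rw [inner_integral_apply hT]
  exact norm_integral_le_integral_norm _

/-- The trace is not continuous in operator norm, so Bochner integrability is not enough; the
uniform trace norm bound `K` supplies the summability for the exchange. -/
theorem hasSum_trace_integral [TopologicalSpace.SeparableSpace H] (hT : Integrable T ν)
    (hK : ∀ᵐ s ∂ν, TraceNormLE (T s) K) {ι : Type} (b : HilbertBasis ι ℂ H) {g : S → ℂ}
    (hg : ∀ᵐ s ∂ν, HasSum (fun i => inner ℂ (b i) (T s (b i))) (g s)) :
    HasSum (fun i => inner ℂ (b i) ((∫ s, T s ∂ν) (b i))) (∫ s, g s ∂ν) := by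
  have := countable_of_orthonormal b.orthonormal
  have h1 : Summable fun i => ∫ s, ‖inner ℂ (b i) (T s (b i))‖ ∂ν :=
    summable_of_sum_le (fun i => integral_nonneg fun z => norm_nonneg _)
      fun s => sum_integral_norm_inner_le hT hK s b.orthonormal b.orthonormal
  have h2 := hasSum_integral_of_summable_integral_norm
    (fun i => integrable_inner_apply hT (b i) (b i)) h1
  simp_rw [inner_integral_apply hT]
  have h3 : ∫ s, g s ∂ν = ∫ s, ∑' i, inner ℂ (b i) (T s (b i)) ∂ν := by
    refine integral_congr_ae ?_
    filter_upwards [hg] with s hs using hs.tsum_eq.symm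
  rw [h3]
  exact h2

end BochnerIntegral

end TraceClass

/-! ### Trace norm and trace of the Duhamel integrand. -/

section HeatPotential

/-- Splitting the time in half writes the heat operator as `∫ |k_z⟩⟨k_z| dz` with kernel vectors
`k_z` at time `s / 2`. This is the source of all rank-one representations below. -/
theorem inner_heatOp_eq_integral {s : ℝ} (hs : 0 < s) (f e : L2 n) :
    inner ℂ f (heatOp s e) =
      ∫ z, inner ℂ f (kerVec (s / 2) z) * inner ℂ (kerVec (s / 2) z) e := by
  have h : heatOp (n := n) s = heatOp (s / 2) ∘L heatOp (s / 2) := by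
    rw [heatOp_comp (by positivity) (by positivity), add_halves]
  rw [h, ContinuousLinearMap.comp_apply, ← inner_heatOp_left, L2.inner_def]
  refine integral_congr_ae ?_
  filter_upwards [heatOp_ae (half_pos hs) f, heatOp_ae (half_pos hs) e] with z h1 h2
  rw [h1, h2, RCLike.inner_apply, inner_conj_symm, mul_comm]

variable {V : EuclideanSpace ℝ (Fin n) → ℝ} (hV : MemLp V ∞ volume)

theorem potOp_ae (f : L2 n) : potOp V hV f =ᵐ[volume] fun x => (V x : ℂ) * f x := by
  filter_upwards [mulOp_ae (hV.ofReal (K := ℂ)).toLp f, (hV.ofReal (K := ℂ)).coeFn_toLp]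
    with x h1 h2
  rw [potOp, h1, h2]
  rfl

theorem inner_potOp_left (f g : L2 n) :
    inner ℂ (potOp V hV f) g = inner ℂ f (potOp V hV g) := by
  rw [L2.inner_def, L2.inner_def]
  refine integral_congr_ae ?_
  filter_upwards [potOp_ae hV f, potOp_ae hV g] with x h1 h2
  rw [h1, h2]
  simp only [RCLike.inner_apply, map_mul, Complex.conj_ofReal]
  ring

variable (hVc : HasCompactSupport V)

theorem potL2_ae : potL2 V hV hVc =ᵐ[volume] fun x => (V x : ℂ) := MemLp.coeFn_toLp _

include hVc in
theorem exists_norm_potOp_kerVec_le {s : ℝ} (hs : 0 < s) :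
    ∃ C, ∀ z, ‖potOp V hV (kerVec s z)‖ ≤ C * Real.exp (-(1 / (8 * s) * ‖z‖ ^ 2)) := by
  obtain ⟨R, hR⟩ := hVc.isCompact.isBounded.exists_norm_le
  refine ⟨(4 * Real.pi * s) ^ (-(n : ℝ) / 2) * Real.exp (R ^ 2 / (4 * s)) * ‖potL2 V hV hVc‖,
    fun z => ?_⟩
  have h : ∀ᵐ y, ‖potOp V hV (kerVec s z) y‖ ≤ ((4 * Real.pi * s) ^ (-(n : ℝ) / 2) *
      Real.exp (R ^ 2 / (4 * s)) * Real.exp (-(1 / (8 * s) * ‖z‖ ^ 2))) *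
      ‖potL2 V hV hVc y‖ := by
    filter_upwards [potOp_ae hV (kerVec s z), kerVec_ae hs z, potL2_ae hV hVc] with y h1 h2 h3
    rw [h1, h2, h3, norm_mul, mul_comm]
    by_cases hy : V y = 0
    · simp [hy]
    refine mul_le_mul_of_nonneg_right ?_ (norm_nonneg _)
    rw [Complex.norm_real, Real.norm_of_nonneg (heatKer_nonneg hs _), heatKer,
      mul_assoc _ (Real.exp (R ^ 2 / (4 * s))), ← Real.exp_add]
    refine mul_le_mul_of_nonneg_left (Real.exp_le_exp.2 ?_) (by positivity)
    have hyR : ‖y‖ ≤ R := hR y (subset_tsupport V hy)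
    have h4 : ‖z‖ ≤ ‖z - y‖ + ‖y‖ := by simpa using norm_add_le (z - y) y
    -- On the support of `V`, where `‖y‖ ≤ R`, half of the Gaussian exponent in `z - y` becomes
    -- decay in `z`.
    have h5 : ‖z‖ ^ 2 ≤ 2 * ‖z - y‖ ^ 2 + 2 * R ^ 2 := by
      nlinarith [norm_nonneg z, norm_nonneg y, norm_nonneg (z - y), sq_nonneg (‖z - y‖ - ‖y‖)]
    have h6 : R ^ 2 / (4 * s) + -(1 / (8 * s) * ‖z‖ ^ 2) + ‖z - y‖ ^ 2 / (4 * s) =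
        (2 * ‖z - y‖ ^ 2 + 2 * R ^ 2 - ‖z‖ ^ 2) / (8 * s) := by
      field_simp; ring
    have h7 : 0 ≤ (2 * ‖z - y‖ ^ 2 + 2 * R ^ 2 - ‖z‖ ^ 2) / (8 * s) :=
      div_nonneg (by linarith) (by positivity)
    linarith
  refine (Lp.norm_le_mul_norm_of_ae_le_mul h).trans (le_of_eq ?_)
  ring

include hVc in
theorem integrable_norm_potOp_kerVec {s : ℝ} (hs : 0 < s) :
    Integrable fun z => ‖potOp V hV (kerVec s z)‖ := by
  obtain ⟨C, hC⟩ := exists_norm_potOp_kerVec_le hV hVc hs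
  refine ((integrable_exp_neg_mul_norm_sq (c := 1 / (8 * s)) (by positivity)).const_mul C).mono'
    ((potOp V hV).continuous.comp (continuous_kerVec hs)).norm.aestronglyMeasurable
    (Eventually.of_forall fun z => ?_)
  rw [norm_norm]
  exact hC z

section RankOneRepresentation

variable {X Y Y' : L2 n →L[ℂ] L2 n}

/-- `Y'` is the adjoint of `Y`, so `X e^{-sP₀} Y` is the integral of the rank-one operators `|X
k_z⟩⟨Y' k_z|`. -/
theorem inner_comp_heatOp_comp {s : ℝ} (hs : 0 < s)
    (hY : ∀ f g, inner ℂ (Y' f) g = inner ℂ f (Y g)) (f e : L2 n) :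
    inner ℂ f ((X ∘L heatOp s ∘L Y) e) =
      ∫ z, inner ℂ f (X (kerVec (s / 2) z)) * inner ℂ (Y' (kerVec (s / 2) z)) e := by
  rw [ContinuousLinearMap.comp_apply, ContinuousLinearMap.comp_apply,
    ← ContinuousLinearMap.adjoint_inner_left, inner_heatOp_eq_integral hs]
  simp_rw [hY, ContinuousLinearMap.adjoint_inner_left]

theorem aestronglyMeasurable_kerVec_comp (X : L2 n →L[ℂ] L2 n) {s : ℝ} (hs : 0 < s) :
    AEStronglyMeasurable (fun z => X (kerVec s z)) volume :=
  (X.continuous.comp (continuous_kerVec hs)).aestronglyMeasurable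

include hVc in
theorem integrable_norm_mul_norm {s : ℝ} (hs : 0 < s) {κ : ℝ}
    (h : ∀ z, ‖X (kerVec s z)‖ * ‖Y' (kerVec s z)‖ ≤ κ * ‖potOp V hV (kerVec s z)‖) :
    Integrable fun z => ‖X (kerVec s z)‖ * ‖Y' (kerVec s z)‖ := by
  refine ((integrable_norm_potOp_kerVec hV hVc hs).const_mul κ).mono'
    ((aestronglyMeasurable_kerVec_comp X hs).norm.mul (aestronglyMeasurable_kerVec_comp Y' hs).norm)
    (Eventually.of_forall fun z => ?_)
  rw [Real.norm_of_nonneg (by positivity)]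
  exact h z

include hVc in
theorem traceNormLE_comp_heatOp_comp {s : ℝ} (hs : 0 < s)
    (hY : ∀ f g, inner ℂ (Y' f) g = inner ℂ f (Y g)) {κ : ℝ}
    (h : ∀ z, ‖X (kerVec (s / 2) z)‖ * ‖Y' (kerVec (s / 2) z)‖ ≤
      κ * ‖potOp V hV (kerVec (s / 2) z)‖) :
    TraceNormLE (X ∘L heatOp s ∘L Y) (κ * ∫ z, ‖potOp V hV (kerVec (s / 2) z)‖) := by
  have hi := integrable_norm_mul_norm hV hVc (half_pos hs) h
  intro ι t e f he hf
  refine (traceNormLE_of_rankOne (aestronglyMeasurable_kerVec_comp X (half_pos hs))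
    (aestronglyMeasurable_kerVec_comp Y' (half_pos hs)) hi
    (inner_comp_heatOp_comp hs hY) ι t e f he hf).trans ?_
  rw [← integral_const_mul]
  exact integral_mono hi ((integrable_norm_potOp_kerVec hV hVc (half_pos hs)).const_mul κ) h

end RankOneRepresentation

/-- The integrand of `W2`. -/
def duhamel (a b c : ℝ) : L2 n →L[ℂ] L2 n :=
  heatOp a ∘L potOp V hV ∘L heatOp b ∘L potOp V hV ∘L heatOp c

theorem norm_kerVec {s : ℝ} (hs : 0 < s) (z : EuclideanSpace ℝ (Fin n)) :
    ‖kerVec s z‖ = Real.sqrt (heatKer (2 * s) (0 : EuclideanSpace ℝ (Fin n))) := by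
  rw [← norm_kerVec_sq hs z, Real.sqrt_sq (norm_nonneg _)]

theorem norm_heatOp_apply_le (s : ℝ) (f : L2 n) : ‖heatOp s f‖ ≤ ‖f‖ :=
  ((heatOp s).le_opNorm f).trans (mul_le_of_le_one_left (norm_nonneg _) (norm_heatOp_le_one s))

theorem heatOp_split {a s : ℝ} (hs : 0 ≤ s) (has : s ≤ a) :
    heatOp (n := n) a = heatOp s ∘L heatOp (a - s) := by
  rw [heatOp_comp hs (sub_nonneg.2 has), add_sub_cancel]

theorem heatOp_split' {a s : ℝ} (hs : 0 ≤ s) (has : s ≤ a) :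
    heatOp (n := n) a = heatOp (a - s) ∘L heatOp s := by
  rw [heatOp_comp (sub_nonneg.2 has) hs, sub_add_cancel]

/-- The bound for the trace norm of a product of two potentials and of heat operators, one of which
acts for a time at least `s`. -/
def duhamelBound (s : ℝ) : ℝ :=
  (‖potOp V hV‖ * Real.sqrt (heatKer (2 * (s / 2)) (0 : EuclideanSpace ℝ (Fin n)))) *
    ∫ z, ‖potOp V hV (kerVec (s / 2) z)‖

theorem norm_heatOp_potOp_heatOp_potOp_le (a b : ℝ) (f : L2 n) :
    ‖heatOp a (potOp V hV (heatOp b (potOp V hV f)))‖ ≤ ‖potOp V hV‖ * ‖potOp V hV f‖ :=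
  (norm_heatOp_apply_le _ _).trans (((potOp V hV).le_opNorm _).trans
    (mul_le_mul_of_nonneg_left (norm_heatOp_apply_le _ _) (norm_nonneg _)))

include hVc in
theorem traceNormLE_duhamel_left {s a b c : ℝ} (hs : 0 < s) (h : s ≤ a) :
    TraceNormLE (duhamel hV a b c) (duhamelBound hV s) := by
  have e : duhamel hV a b c = heatOp (a - s) ∘L heatOp s ∘L
      (potOp V hV ∘L heatOp b ∘L potOp V hV ∘L heatOp c) := by
    rw [duhamel, heatOp_split' hs.le h, ContinuousLinearMap.comp_assoc]
  rw [e]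
  -- The kernel vectors sit in the outer heat factor. One potential acting on them gives
  -- integrability in `z`; the other enters only through its operator norm.
  refine traceNormLE_comp_heatOp_comp hV hVc hs
    (Y' := heatOp c ∘L potOp V hV ∘L heatOp b ∘L potOp V hV) (fun f g => ?_) fun z => ?_
  · simp only [ContinuousLinearMap.comp_apply, inner_heatOp_left, inner_potOp_left]
  · simp only [ContinuousLinearMap.comp_apply]
    have h1 := norm_heatOp_apply_le (a - s) (kerVec (s / 2) z)
    rw [norm_kerVec (half_pos hs)] at h1
    refine (mul_le_mul h1 (norm_heatOp_potOp_heatOp_potOp_le hV c b _) (norm_nonneg _)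
      (Real.sqrt_nonneg _)).trans (le_of_eq ?_)
    ring

include hVc in
theorem traceNormLE_duhamel_mid {s a b c : ℝ} (hs : 0 < s) (h : s ≤ b) :
    TraceNormLE (duhamel hV a b c) (duhamelBound hV s) := by
  have e : duhamel hV a b c = (heatOp a ∘L potOp V hV) ∘L heatOp s ∘L
      (heatOp (b - s) ∘L potOp V hV ∘L heatOp c) := by
    rw [duhamel, heatOp_split hs.le h, ContinuousLinearMap.comp_assoc,
      ContinuousLinearMap.comp_assoc]
  rw [e]
  refine traceNormLE_comp_heatOp_comp hV hVc hs
    (Y' := heatOp c ∘L potOp V hV ∘L heatOp (b - s)) (fun f g => ?_) fun z => ?_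
  · simp only [ContinuousLinearMap.comp_apply, inner_heatOp_left, inner_potOp_left]
  · simp only [ContinuousLinearMap.comp_apply]
    have h1 := norm_heatOp_apply_le a (potOp V hV (kerVec (s / 2) z))
    have h2 := (norm_heatOp_apply_le c (potOp V hV (heatOp (b - s) (kerVec (s / 2) z)))).trans
      (((potOp V hV).le_opNorm _).trans
        (mul_le_mul_of_nonneg_left (norm_heatOp_apply_le _ _) (norm_nonneg _)))
    rw [norm_kerVec (half_pos hs)] at h2
    refine (mul_le_mul h1 h2 (norm_nonneg _) (norm_nonneg _)).trans (le_of_eq ?_)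
    ring

include hVc in
theorem traceNormLE_duhamel_right {s a b c : ℝ} (hs : 0 < s) (h : s ≤ c) :
    TraceNormLE (duhamel hV a b c) (duhamelBound hV s) := by
  have e : duhamel hV a b c = (heatOp a ∘L potOp V hV ∘L heatOp b ∘L potOp V hV) ∘L
      heatOp s ∘L heatOp (c - s) := by
    ext1 f
    have hf : heatOp c f = heatOp s (heatOp (c - s) f) := by
      rw [heatOp_split hs.le h]
      exact ContinuousLinearMap.comp_apply _ _ _
    simp only [duhamel, ContinuousLinearMap.comp_apply]
    rw [hf]
  rw [e]
  refine traceNormLE_comp_heatOp_comp hV hVc hs (Y' := heatOp (c - s))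
    (fun f g => inner_heatOp_left _ _ _) fun z => ?_
  simp only [ContinuousLinearMap.comp_apply]
  have h1 := norm_heatOp_apply_le (c - s) (kerVec (s / 2) z)
  rw [norm_kerVec (half_pos hs)] at h1
  refine (mul_le_mul (norm_heatOp_potOp_heatOp_potOp_le hV a b _) h1 (norm_nonneg _)
    (by positivity)).trans (le_of_eq ?_)
  ring

theorem separableSpace_L2 : TopologicalSpace.SeparableSpace (L2 n) := by
  have : Fact ((2 : ℝ≥0∞) ≠ ∞) := ⟨ENNReal.ofNat_ne_top⟩
  infer_instance

-- The rank-one decomposition is placed in the middle factor, whose time is positive. The outer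
-- factors then meet in the inner product and merge, which is the required cyclicity of the trace.
include hVc in
theorem hasSum_trace_duhamel {a b c : ℝ} (ha : 0 ≤ a) (hb : 0 < b) (hc : 0 ≤ c) {ι : Type}
    (β : HilbertBasis ι ℂ (L2 n)) :
    HasSum (fun i => inner ℂ (β i) (duhamel hV a b c (β i)))
      (∫ z, inner ℂ (potOp V hV (kerVec (b / 2) z))
        (heatOp (a + c) (potOp V hV (kerVec (b / 2) z)))) := by
  have e : duhamel hV a b c = (heatOp a ∘L potOp V hV) ∘L heatOp b ∘L
      (potOp V hV ∘L heatOp c) := by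
    simp only [duhamel, ContinuousLinearMap.comp_assoc]
  have hY : ∀ f g, inner ℂ ((heatOp c ∘L potOp V hV) f) g =
      inner ℂ f ((potOp V hV ∘L heatOp c) g) := fun f g => by
    simp only [ContinuousLinearMap.comp_apply, inner_heatOp_left, inner_potOp_left]
  have hi := integrable_norm_mul_norm (X := heatOp a ∘L potOp V hV) (Y' := heatOp c ∘L potOp V hV)
    hV hVc (half_pos hb)
    (κ := ‖potOp V hV‖ * Real.sqrt (heatKer (2 * (b / 2)) (0 : EuclideanSpace ℝ (Fin n))))
    fun z => by
      simp only [ContinuousLinearMap.comp_apply]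
      have h1 := norm_heatOp_apply_le a (potOp V hV (kerVec (b / 2) z))
      have h2 := (norm_heatOp_apply_le c (potOp V hV (kerVec (b / 2) z))).trans
        ((potOp V hV).le_opNorm _)
      rw [norm_kerVec (half_pos hb)] at h2
      refine (mul_le_mul h1 h2 (norm_nonneg _) (norm_nonneg _)).trans (le_of_eq ?_)
      ring
  have := separableSpace_L2 (n := n)
  have h := hasSum_trace_of_rankOne (aestronglyMeasurable_kerVec_comp _ (half_pos hb))
    (aestronglyMeasurable_kerVec_comp _ (half_pos hb)) hi (inner_comp_heatOp_comp hb hY) β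
  rw [e]
  rw [show (∫ z, inner ℂ (potOp V hV (kerVec (b / 2) z))
        (heatOp (a + c) (potOp V hV (kerVec (b / 2) z)))) =
      ∫ z, inner ℂ ((heatOp c ∘L potOp V hV) (kerVec (b / 2) z))
        ((heatOp a ∘L potOp V hV) (kerVec (b / 2) z)) from ?_]
  · exact h
  refine integral_congr_ae (Eventually.of_forall fun z => ?_)
  simp only [ContinuousLinearMap.comp_apply]
  rw [inner_heatOp_left, ← ContinuousLinearMap.comp_apply (heatOp c), heatOp_comp hc ha, add_comm]

end HeatPotential

/-! ### The trace of the integrand as a quadratic form in `V`. -/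

open scoped Pointwise

section TraceFormula

variable {V : EuclideanSpace ℝ (Fin n) → ℝ} (hV : MemLp V ∞ volume)
  (hVc : HasCompactSupport V)

theorem inner_kerVec_eq_integral {s : ℝ} (hs : 0 < s) (x y : EuclideanSpace ℝ (Fin n)) :
    Integrable (fun z => heatKer s (z - x) * heatKer s (z - y)) ∧
      ∫ z, heatKer s (z - x) * heatKer s (z - y) = heatKer (2 * s) (x - y) := by
  have h : (fun z => inner ℂ (kerVec s x z) (kerVec s y z)) =ᵐ[volume]
      fun z => ((heatKer s (z - x) * heatKer s (z - y) : ℝ) : ℂ) := by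
    filter_upwards [kerVec_ae hs x, kerVec_ae hs y] with z h1 h2
    rw [h1, h2, RCLike.inner_apply, Complex.conj_ofReal, ← heatKer_neg s (z - x), neg_sub,
      ← heatKer_neg s (z - y), neg_sub, mul_comm, Complex.ofReal_mul]
  constructor
  · have h1 := ((L2.integrable_inner (𝕜 := ℂ) (kerVec s x) (kerVec s y)).congr h).re
    simpa using h1
  · have h1 := inner_kerVec_kerVec hs x y
    rw [L2.inner_def, integral_congr_ae h, integral_complex_ofReal] at h1
    exact Complex.ofReal_injective h1

include hV hVc in
theorem integrable_potential : Integrable V := by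
  have h1 : MemLp V 1 volume :=
    hV.mono_exponent_of_measure_support_ne_top (s := tsupport V)
      (fun _ hx => image_eq_zero_of_notMem_tsupport hx) hVc.isCompact.measure_lt_top.ne le_top
  exact memLp_one_iff_integrable.1 h1

/-- The integrand of the triple integral for the trace of `e^{-αP₀} V e^{-2sP₀} V`. -/
def traceIntegrand (V : EuclideanSpace ℝ (Fin n) → ℝ) (α s : ℝ)
    (p : EuclideanSpace ℝ (Fin n) × EuclideanSpace ℝ (Fin n) × EuclideanSpace ℝ (Fin n)) : ℝ :=
  (V p.2.1 * V p.2.2 * heatKer α (p.2.1 - p.2.2)) *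
    (heatKer s (p.1 - p.2.1) * heatKer s (p.1 - p.2.2))

include hV hVc in
theorem integrable_potential_mul {f : EuclideanSpace ℝ (Fin n) × EuclideanSpace ℝ (Fin n) → ℝ}
    (hf : Continuous f) {C : ℝ} (hC : ∀ p, ‖f p‖ ≤ C) :
    Integrable fun p : EuclideanSpace ℝ (Fin n) × EuclideanSpace ℝ (Fin n) =>
      V p.1 * V p.2 * f p := by
  have h := (integrable_potential hV hVc).mul_prod (integrable_potential hV hVc)
  exact h.mul_bdd (c := C) hf.aestronglyMeasurable (Eventually.of_forall hC)

theorem norm_heatKer_le {s : ℝ} (hs : 0 < s) (x : EuclideanSpace ℝ (Fin n)) :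
    ‖heatKer s x‖ ≤ (4 * Real.pi * s) ^ (-(n : ℝ) / 2) := by
  rw [Real.norm_of_nonneg (heatKer_nonneg hs x)]
  exact heatKer_le hs x

-- Integrating the absolute value over `z` first leaves `|V(x) V(y)|` times a bounded function,
-- which is integrable. This licenses Fubini in `integral_inner_potOp_kerVec`.
include hV hVc in
theorem integrable_traceIntegrand {α s : ℝ} (hα : 0 < α) (hs : 0 < s) :
    Integrable (traceIntegrand V α s) (volume.prod volume) := by
  have hVi := (integrable_potential hV hVc).aestronglyMeasurable
  have hm : AEStronglyMeasurable (traceIntegrand V α s) (volume.prod volume) := by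
    have h1 : AEStronglyMeasurable (fun q : EuclideanSpace ℝ (Fin n) × EuclideanSpace ℝ (Fin n) =>
        V q.1 * V q.2 * heatKer α (q.1 - q.2)) (volume.prod volume) :=
      ((hVi.comp_fst).mul (hVi.comp_snd)).mul
        (Continuous.aestronglyMeasurable (by fun_prop))
    exact (h1.comp_snd).mul (Continuous.aestronglyMeasurable (by fun_prop))
  rw [integrable_prod_iff' hm]
  refine ⟨Eventually.of_forall fun q => ?_, ?_⟩
  · exact (inner_kerVec_eq_integral hs q.1 q.2).1.const_mul (V q.1 * V q.2 * heatKer α (q.1 - q.2))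
  · have h1 := (integrable_potential_mul hV hVc (f := fun q => heatKer α (q.1 - q.2) *
      heatKer (2 * s) (q.1 - q.2)) (by fun_prop)
      (C := (4 * Real.pi * α) ^ (-(n : ℝ) / 2) * (4 * Real.pi * (2 * s)) ^ (-(n : ℝ) / 2))
      fun q => by
        rw [norm_mul]
        exact mul_le_mul (norm_heatKer_le hα _) (norm_heatKer_le (by positivity) _) (norm_nonneg _)
          (by positivity)).norm
    refine h1.congr (Eventually.of_forall fun q => ?_)
    simp only [traceIntegrand, norm_mul]
    rw [integral_const_mul, Real.norm_of_nonneg (heatKer_nonneg (by positivity : 0 < 2 * s) _),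
      ← (inner_kerVec_eq_integral hs q.1 q.2).2]
    have h2 : ∀ z, ‖heatKer s (z - q.1)‖ * ‖heatKer s (z - q.2)‖ =
        heatKer s (z - q.1) * heatKer s (z - q.2) := fun z => by
      rw [Real.norm_of_nonneg (heatKer_nonneg hs _), Real.norm_of_nonneg (heatKer_nonneg hs _)]
    simp_rw [h2]
    ring

theorem inner_potOp_kerVec_heatOp {α s : ℝ} (hα : 0 < α) (hs : 0 < s)
    (z : EuclideanSpace ℝ (Fin n)) :
    inner ℂ (potOp V hV (kerVec s z)) (heatOp α (potOp V hV (kerVec s z))) =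
      ((∫ x, ∫ y, traceIntegrand V α s (z, x, y) : ℝ) : ℂ) := by
  rw [L2.inner_def, ← integral_complex_ofReal]
  refine integral_congr_ae ?_
  filter_upwards [potOp_ae hV (kerVec s z), kerVec_ae hs z,
    heatOp_ae hα (potOp V hV (kerVec s z))] with x h1 h2 h3
  rw [h1, h2, h3, L2.inner_def, ← integral_complex_ofReal, RCLike.inner_apply, ← integral_mul_const]
  refine integral_congr_ae ?_
  filter_upwards [kerVec_ae hα x, potOp_ae hV (kerVec s z), kerVec_ae hs z] with y h4 h5 h6
  rw [h4, h5, h6, RCLike.inner_apply, traceIntegrand]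
  simp only [map_mul, Complex.conj_ofReal]
  push_cast
  ring

theorem inner_potL2_heatOp {γ : ℝ} (hγ : 0 < γ) :
    inner ℂ (potL2 V hV hVc) (heatOp γ (potL2 V hV hVc)) =
      ((∫ x, ∫ y, V x * V y * heatKer γ (x - y) : ℝ) : ℂ) := by
  rw [L2.inner_def, ← integral_complex_ofReal]
  refine integral_congr_ae ?_
  filter_upwards [potL2_ae hV hVc, heatOp_ae hγ (potL2 V hV hVc)] with x h1 h3
  rw [h1, h3, L2.inner_def, ← integral_complex_ofReal, RCLike.inner_apply, ← integral_mul_const]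
  refine integral_congr_ae ?_
  filter_upwards [kerVec_ae hγ x, potL2_ae hV hVc] with y h4 h5
  rw [h4, h5, RCLike.inner_apply]
  simp only [Complex.conj_ofReal]
  push_cast
  ring

/-- Fubini moves the `z` integral inside, where it rebuilds the heat kernel at time `2 * (b / 2) =
b`; the product of the kernels at times `α` and `b` is then one Gaussian. -/
theorem integral_inner_potOp_kerVec {α b : ℝ} (hα : 0 < α) (hb : 0 < b) :
    ∫ z, inner ℂ (potOp V hV (kerVec (b / 2) z)) (heatOp α (potOp V hV (kerVec (b / 2) z))) =
      (((4 * Real.pi * (α + b)) ^ (-(n : ℝ) / 2) : ℝ) : ℂ) *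
        inner ℂ (potL2 V hV hVc) (heatOp (α * b / (α + b)) (potL2 V hV hVc)) := by
  have hs := half_pos hb
  simp_rw [inner_potOp_kerVec_heatOp hV hα hs]
  rw [integral_complex_ofReal, inner_potL2_heatOp hV hVc (by positivity), ← Complex.ofReal_mul]
  congr 1
  have hI := integrable_traceIntegrand hV hVc hα hs
  have h1 : ∫ z, ∫ x, ∫ y, traceIntegrand V α (b / 2) (z, x, y) =
      ∫ z, ∫ q, traceIntegrand V α (b / 2) (z, q) := by
    refine integral_congr_ae ?_
    filter_upwards [hI.prod_right_ae] with z hz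
    exact (integral_prod _ hz).symm
  have h2 : ∀ q : EuclideanSpace ℝ (Fin n) × EuclideanSpace ℝ (Fin n),
      ∫ z, traceIntegrand V α (b / 2) (z, q) = (4 * Real.pi * (α + b)) ^ (-(n : ℝ) / 2) *
        (V q.1 * V q.2 * heatKer (α * b / (α + b)) (q.1 - q.2)) := by
    intro q
    simp only [traceIntegrand]
    rw [integral_const_mul, (inner_kerVec_eq_integral hs q.1 q.2).2, mul_assoc,
      mul_div_cancel₀ b two_ne_zero, heatKer_mul_heatKer hα hb]
    ring
  have h3 : Integrable fun q : EuclideanSpace ℝ (Fin n) × EuclideanSpace ℝ (Fin n) =>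
      V q.1 * V q.2 * heatKer (α * b / (α + b)) (q.1 - q.2) :=
    integrable_potential_mul hV hVc (by fun_prop) fun q => norm_heatKer_le (by positivity) _
  rw [h1, integral_integral_swap (f := fun z q => traceIntegrand V α (b / 2) (z, q)) hI]
  simp_rw [h2]
  rw [integral_const_mul]
  congr 1
  exact integral_prod _ h3

/-! ### Integration over the simplex of times. -/

/-- The open simplex of pairs of times. -/
def simplex (t : ℝ) : Set (ℝ × ℝ) := {s | 0 < s.1 ∧ s.1 < s.2 ∧ s.2 < t}

theorem isOpen_simplex (t : ℝ) : IsOpen (simplex t) := by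
  refine IsOpen.and ?_ (IsOpen.and ?_ ?_)
  · exact isOpen_lt continuous_const continuous_fst
  · exact isOpen_lt continuous_fst continuous_snd
  · exact isOpen_lt continuous_snd continuous_const

theorem volume_simplex_lt_top (t : ℝ) : volume (simplex t) < ∞ := by
  refine (measure_mono (t := Set.Icc (0 : ℝ × ℝ) (t, t)) ?_).trans_lt
    isCompact_Icc.measure_lt_top
  rintro ⟨a, b⟩ ⟨h1, h2, h3⟩
  simp only at h1 h2 h3
  exact ⟨⟨h1.le, (h1.trans h2).le⟩, ⟨(h2.trans h3).le, h3.le⟩⟩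

instance (t : ℝ) : IsFiniteMeasure (volume.restrict (simplex t)) :=
  ⟨by rw [Measure.restrict_apply_univ]; exact volume_simplex_lt_top t⟩

theorem smul_simplex_one {t : ℝ} (ht : 0 < t) : t • simplex 1 = simplex t := by
  ext ⟨a, b⟩
  rw [Set.mem_smul_set_iff_inv_smul_mem₀ ht.ne']
  simp only [simplex, Set.mem_ofPred_eq, Prod.smul_mk, smul_eq_mul]
  rw [mul_lt_mul_iff_right₀ (inv_pos.2 ht), inv_mul_lt_iff₀ ht, mul_one]
  have : 0 < t⁻¹ * a ↔ 0 < a := by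
    rw [mul_pos_iff_of_pos_left (inv_pos.2 ht)]
  rw [this]

theorem integrableOn_duhamel (t : ℝ) :
    IntegrableOn (fun s : ℝ × ℝ => duhamel hV (t - s.2) (s.2 - s.1) s.1) (simplex t) := by
  refine (integrable_const (‖potOp V hV‖ * ‖potOp V hV‖)).mono' ?_ ?_
  · have hc : ContinuousOn (fun s : ℝ × ℝ => duhamel hV (t - s.2) (s.2 - s.1) s.1)
        (simplex t) := by
      have h1 : ContinuousOn (fun s : ℝ × ℝ => heatOp (n := n) (t - s.2)) (simplex t) :=
        continuousOn_heatOp.comp (by fun_prop) fun s hs => sub_pos.2 hs.2.2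
      have h2 : ContinuousOn (fun s : ℝ × ℝ => heatOp (n := n) (s.2 - s.1)) (simplex t) :=
        continuousOn_heatOp.comp (by fun_prop) fun s hs => sub_pos.2 hs.2.1
      have h3 : ContinuousOn (fun s : ℝ × ℝ => heatOp (n := n) s.1) (simplex t) :=
        continuousOn_heatOp.comp (by fun_prop) fun s hs => hs.1
      exact h1.clm_comp (continuousOn_const.clm_comp
        (h2.clm_comp (continuousOn_const.clm_comp h3)))
    exact hc.aestronglyMeasurable (isOpen_simplex t).measurableSet
  · refine Eventually.of_forall fun s => ?_
    refine ContinuousLinearMap.opNorm_le_bound _ (by positivity) fun f => ?_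
    simp only [duhamel, ContinuousLinearMap.comp_apply]
    refine (norm_heatOp_apply_le _ _).trans (((potOp V hV).le_opNorm _).trans ?_)
    rw [mul_assoc]
    refine mul_le_mul_of_nonneg_left ?_ (norm_nonneg _)
    refine (norm_heatOp_apply_le _ _).trans (((potOp V hV).le_opNorm _).trans ?_)
    exact mul_le_mul_of_nonneg_left (norm_heatOp_apply_le _ _) (norm_nonneg _)

theorem W2_eq (t : ℝ) :
    W2 V hV t = ∫ s in simplex t, duhamel hV (t - s.2) (s.2 - s.1) s.1 := rfl

-- The three times add up to `t`, so one of them is at least `t / 3`, and that factor carries the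
-- trace norm bound.
include hVc in
theorem ae_traceNormLE_duhamel {t : ℝ} (ht : 0 < t) : ∀ᵐ s ∂volume.restrict (simplex t),
    TraceNormLE (duhamel hV (t - s.2) (s.2 - s.1) s.1) (duhamelBound hV (t / 3)) := by
  have ht3 : 0 < t / 3 := by positivity
  refine Eventually.of_forall fun s => ?_
  by_cases h1 : t / 3 ≤ t - s.2
  · exact traceNormLE_duhamel_left hV hVc ht3 h1
  by_cases h2 : t / 3 ≤ s.2 - s.1
  · exact traceNormLE_duhamel_mid hV hVc ht3 h2
  exact traceNormLE_duhamel_right hV hVc ht3 (by linarith)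

include hVc in
theorem isTraceClass_W2 {t : ℝ} (ht : 0 < t) : IsTraceClass (W2 V hV t) := by
  rw [W2_eq]
  exact (traceNormLE_integral (integrableOn_duhamel hV t)
    (ae_traceNormLE_duhamel hV hVc ht)).isTraceClass

theorem opTrace_W2 {t : ℝ} (ht : 0 < t) : opTrace (W2 V hV t) =
    (((4 * Real.pi * t) ^ (-(n : ℝ) / 2) : ℝ) : ℂ) * ∫ s in simplex t,
      inner ℂ (potL2 V hV hVc)
        (heatOp ((t - (s.2 - s.1)) * (s.2 - s.1) / t) (potL2 V hV hVc)) := by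
  have := separableSpace_L2 (n := n)
  rw [← integral_const_mul, opTrace, W2_eq]
  refine (hasSum_trace_integral (integrableOn_duhamel hV t) (ae_traceNormLE_duhamel hV hVc ht) _
    ?_).tsum_eq
  filter_upwards [ae_restrict_mem (isOpen_simplex t).measurableSet] with s hs
  obtain ⟨h1, h2, h3⟩ := hs
  have h := hasSum_trace_duhamel hV hVc (a := t - s.2) (b := s.2 - s.1) (c := s.1)
    (sub_nonneg.2 h3.le) (sub_pos.2 h2) h1.le
    (exists_hilbertBasis ℂ (L2 n)).choose_spec.choose
  rw [integral_inner_potOp_kerVec hV hVc (by linarith) (sub_pos.2 h2)] at h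
  have e1 : t - s.2 + s.1 = t - (s.2 - s.1) := by ring
  have e2 : t - (s.2 - s.1) + (s.2 - s.1) = t := by ring
  rwa [e1, e2] at h

/-! ### The trace of `W2` as a Laplace transform. -/

/-- The weight in the time integral after rescaling. -/
def timeWeight (s : ℝ × ℝ) : ℝ := |(s.2 - s.1) * (1 - (s.2 - s.1))|

theorem continuous_timeWeight : Continuous timeWeight := by
  unfold timeWeight; fun_prop

/-- The absolute value only serves to make the phase nonnegative everywhere; on the simplex `0 < s.2
- s.1 < 1`, so it changes nothing there. -/
theorem timeWeight_of_mem {s : ℝ × ℝ} (hs : s ∈ simplex 1) :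
    timeWeight s = (s.2 - s.1) * (1 - (s.2 - s.1)) ∧ 0 < timeWeight s := by
  obtain ⟨h1, h2, h3⟩ := hs
  have h : 0 < (s.2 - s.1) * (1 - (s.2 - s.1)) := mul_pos (by linarith) (by linarith)
  rw [timeWeight, abs_of_pos h]
  exact ⟨rfl, h⟩

/-- The density `|𝓕 f|²`. -/
def spectralDensity (f : L2 n) (ξ : EuclideanSpace ℝ (Fin n)) : NNReal := ‖(𝓕 f : L2 n) ξ‖₊ ^ 2

theorem measurable_spectralDensity (f : L2 n) : Measurable (spectralDensity f) :=
  (Lp.stronglyMeasurable (𝓕 f : L2 n)).measurable.nnnorm.pow_const 2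

theorem integrable_spectralDensity (f : L2 n) :
    Integrable fun ξ => (spectralDensity f ξ : ℝ) := by
  have := (memLp_two_iff_integrable_sq_norm (Lp.memLp (𝓕 f : L2 n)).1).1 (Lp.memLp (𝓕 f : L2 n))
  simpa [spectralDensity] using this

/-- The spectral measure `|𝓕 f|² dξ` of `f`. -/
def spectralMeasure (f : L2 n) : Measure (EuclideanSpace ℝ (Fin n)) :=
  volume.withDensity fun ξ => spectralDensity f ξ

instance (f : L2 n) : IsFiniteMeasure (spectralMeasure f) := by
  refine isFiniteMeasure_withDensity ?_
  have h := (integrable_spectralDensity f).2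
  rw [hasFiniteIntegral_iff_enorm] at h
  refine ne_of_lt (lt_of_eq_of_lt (lintegral_congr fun ξ => ?_) h)
  rw [Real.enorm_of_nonneg (NNReal.coe_nonneg _), ENNReal.ofReal_coe_nnreal]

theorem integral_spectralMeasure (f : L2 n) (g : EuclideanSpace ℝ (Fin n) → ℝ) :
    ∫ ξ, g ξ ∂spectralMeasure f = ∫ ξ, ‖(𝓕 f : L2 n) ξ‖ ^ 2 * g ξ := by
  rw [spectralMeasure, integral_withDensity_eq_integral_smul (measurable_spectralDensity f)]
  refine integral_congr_ae (Eventually.of_forall fun ξ => ?_)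
  simp [spectralDensity, NNReal.smul_def]

theorem inner_heatOp_self {γ : ℝ} (hγ : 0 ≤ γ) (f : L2 n) : inner ℂ f (heatOp γ f) =
    ((∫ ξ, Real.exp (-(γ * (2 * Real.pi * ‖ξ‖) ^ 2)) ∂spectralMeasure f : ℝ) : ℂ) := by
  rw [integral_spectralMeasure, ← Lp.inner_fourier_eq, L2.inner_def, ← integral_complex_ofReal]
  refine integral_congr_ae ?_
  filter_upwards [fourier_heatOp_ae γ f] with ξ h
  rw [h, heatSymbol_of_nonneg hγ, RCLike.inner_apply, mul_assoc, mul_comm, Complex.ofReal_mul,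
    RCLike.mul_conj]
  norm_cast
  exact (Complex.ofReal_mul _ _).symm

/-- The measure space on which the trace of `W2` is a Laplace transform. -/
def phaseMeasure (f : L2 n) : Measure ((ℝ × ℝ) × EuclideanSpace ℝ (Fin n)) :=
  (volume.restrict (simplex 1)).prod (spectralMeasure f)

instance (f : L2 n) : IsFiniteMeasure (phaseMeasure f) := by
  unfold phaseMeasure; infer_instance

/-- The phase function of the Laplace transform representing the trace of `W2`. -/
def phase (p : (ℝ × ℝ) × EuclideanSpace ℝ (Fin n)) : ℝ :=
  timeWeight p.1 * (2 * Real.pi * ‖p.2‖) ^ 2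

theorem phase_nonneg (p : (ℝ × ℝ) × EuclideanSpace ℝ (Fin n)) : 0 ≤ phase p :=
  mul_nonneg (abs_nonneg _) (sq_nonneg _)

theorem measurable_phase : Measurable (phase (n := n)) := by
  have := continuous_timeWeight
  refine Continuous.measurable ?_
  unfold phase
  fun_prop

theorem opTrace_W2_eq_laplace {t : ℝ} (ht : 0 < t) : opTrace (W2 V hV t) =
    (((4 * Real.pi * t) ^ (-(n : ℝ) / 2) : ℝ) : ℂ) *
      (((∫ p, Real.exp (-(t * phase p)) ∂phaseMeasure (potL2 V hV hVc) : ℝ) : ℂ) * (t : ℂ) ^ 2) := by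
  rw [opTrace_W2 hV hVc ht]
  congr 1
  -- Scaling the two times by `t` produces the factor `t ^ 2` and turns the effective heat time into
  -- `t * timeWeight s`.
  have h1 := Measure.setIntegral_comp_smul_of_pos volume (fun s : ℝ × ℝ =>
      inner ℂ (potL2 V hV hVc)
        (heatOp ((t - (s.2 - s.1)) * (s.2 - s.1) / t) (potL2 V hV hVc))) (simplex 1) ht
  rw [smul_simplex_one ht, Module.finrank_prod, Module.finrank_self] at h1
  have h2 : ∫ s in simplex 1, inner ℂ (potL2 V hV hVc)
        (heatOp ((t - ((t • s).2 - (t • s).1)) * ((t • s).2 - (t • s).1) / t) (potL2 V hV hVc)) =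
      ((∫ p, Real.exp (-(t * phase p)) ∂phaseMeasure (potL2 V hV hVc) : ℝ) : ℂ) := by
    rw [phaseMeasure, integral_prod _ (by
      exact integrable_exp_neg_mul (M := phaseMeasure (potL2 V hV hVc)) measurable_phase
        phase_nonneg ht.le), ← integral_complex_ofReal]
    refine setIntegral_congr_fun (isOpen_simplex 1).measurableSet fun s hs => ?_
    have e : (t - ((t • s).2 - (t • s).1)) * ((t • s).2 - (t • s).1) / t = t * timeWeight s := by
      rw [(timeWeight_of_mem hs).1]
      simp only [Prod.smul_fst, Prod.smul_snd, smul_eq_mul]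
      field_simp
    rw [e, inner_heatOp_self (mul_nonneg ht.le (timeWeight_of_mem hs).2.le)]
    simp only [phase, mul_assoc]
  rw [← h2, h1, mul_comm]
  have ht0 : (t : ℂ) ≠ 0 := Complex.ofReal_ne_zero.2 ht.ne'
  rw [Complex.real_smul, ← mul_assoc]
  push_cast
  field_simp

end TraceFormula

/-! ### Sobolev spaces as moment conditions on the spectral measure. -/

section Sobolev

theorem memH_iff_memLp (s : ℝ) (f : L2 n) : MemH s f ↔
    MemLp (fun ξ => (((1 + ‖ξ‖ ^ 2) ^ (s / 2) : ℝ) : ℂ) * (𝓕 f : L2 n) ξ) 2 volume := by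
  have hg : (fun ξ : EuclideanSpace ℝ (Fin n) =>
      (((1 + ‖ξ‖ ^ 2) ^ (s / 2) : ℝ) : ℂ)).HasTemperateGrowth := by fun_prop
  have hpair : ∀ φ : 𝓢(EuclideanSpace ℝ (Fin n), ℂ),
      TemperedDistribution.smulLeftCLM ℂ (fun ξ : EuclideanSpace ℝ (Fin n) =>
        (((1 + ‖ξ‖ ^ 2) ^ (s / 2) : ℝ) : ℂ)) ((𝓕 f : L2 n) : 𝓢'(EuclideanSpace ℝ (Fin n), ℂ)) φ =
      ∫ ξ, φ ξ • ((((1 + ‖ξ‖ ^ 2) ^ (s / 2) : ℝ) : ℂ) * (𝓕 f : L2 n) ξ) := by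
    intro φ
    rw [TemperedDistribution.smulLeftCLM_apply_apply, Lp.toTemperedDistribution_apply]
    refine integral_congr_ae (Eventually.of_forall fun ξ => ?_)
    simp only
    rw [SchwartzMap.smulLeftCLM_apply_apply hg, smul_eq_mul, smul_eq_mul, smul_eq_mul]
    ring
  rw [MemH, TemperedDistribution.memSobolev_iff_exists_smulLeftCLM_fourier,
    Lp.fourier_toTemperedDistribution_eq]
  constructor
  · rintro ⟨f', hf'⟩
    refine (Lp.memLp f').ae_eq ?_
    refine ae_eq_of_integral_contDiff_smul_eq ((Lp.memLp _).locallyIntegrable one_le_two)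
      ?_ fun φ hφ hφc => ?_
    · have h1 : LocallyIntegrable (fun ξ => (𝓕 f : L2 n) ξ) :=
        (Lp.memLp (𝓕 f : L2 n)).locallyIntegrable one_le_two
      exact h1.continuous_mul hg.1.continuous
    · have h1 : HasCompactSupport (Complex.ofRealCLM ∘ φ) := hφc.comp_left rfl
      have h2 : ContDiff ℝ ((⊤ : ℕ∞) : WithTop ℕ∞) (Complex.ofRealCLM ∘ φ) := by fun_prop
      have h3 := hpair (h1.toSchwartzMap h2)
      rw [hf', Lp.toTemperedDistribution_apply] at h3
      simpa using h3
  · intro h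
    refine ⟨h.toLp, ?_⟩
    ext φ
    rw [hpair, Lp.toTemperedDistribution_apply]
    refine integral_congr_ae ?_
    filter_upwards [h.coeFn_toLp] with ξ hξ
    rw [hξ]

theorem integrable_spectralMeasure_iff (f : L2 n) (g : EuclideanSpace ℝ (Fin n) → ℝ) :
    Integrable g (spectralMeasure f) ↔ Integrable fun ξ => ‖(𝓕 f : L2 n) ξ‖ ^ 2 * g ξ := by
  rw [spectralMeasure, integrable_withDensity_iff_integrable_smul (measurable_spectralDensity f)]
  simp [spectralDensity, NNReal.smul_def]

theorem memLp_ofReal_mul_fourier_iff (f : L2 n) {g : EuclideanSpace ℝ (Fin n) → ℝ}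
    (hg : Continuous g) : MemLp (fun ξ => (g ξ : ℂ) * (𝓕 f : L2 n) ξ) 2 volume ↔
      Integrable (fun ξ => g ξ ^ 2) (spectralMeasure f) := by
  have hm : AEStronglyMeasurable (fun ξ => (g ξ : ℂ) * (𝓕 f : L2 n) ξ) volume :=
    (Complex.continuous_ofReal.comp hg).aestronglyMeasurable.mul (Lp.memLp _).1
  rw [memLp_two_iff_integrable_sq_norm hm, integrable_spectralMeasure_iff]
  refine integrable_congr (Eventually.of_forall fun ξ => ?_)
  simp only
  rw [norm_mul, Complex.norm_real, mul_pow, Real.norm_eq_abs, sq_abs, mul_comm]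

/-- The spectral measure is finite, so the inhomogeneous weight `(1 + ‖ξ‖ ^ 2) ^ m` and the
homogeneous one are integrable together. -/
theorem memH_natCast_iff (m : ℕ) (f : L2 n) : MemH (m : ℝ) f ↔
    Integrable (fun ξ => ((2 * Real.pi * ‖ξ‖) ^ 2) ^ m) (spectralMeasure f) := by
  have hc : Continuous fun ξ : EuclideanSpace ℝ (Fin n) => (1 + ‖ξ‖ ^ 2) ^ ((m : ℝ) / 2) :=
    Continuous.rpow_const (by fun_prop) fun ξ => Or.inl (by positivity)
  have he : ∀ ξ : EuclideanSpace ℝ (Fin n), ((1 + ‖ξ‖ ^ 2) ^ ((m : ℝ) / 2)) ^ 2 =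
      (1 + ‖ξ‖ ^ 2) ^ m := fun ξ => by
    rw [← Real.rpow_mul_natCast (by positivity)]
    simp
  rw [memH_iff_memLp, memLp_ofReal_mul_fourier_iff f hc]
  simp_rw [he]
  constructor
  · intro h
    refine (h.const_mul (((2 * Real.pi) ^ 2) ^ m)).mono'
      (Continuous.aestronglyMeasurable (by fun_prop)) (Eventually.of_forall fun ξ => ?_)
    rw [Real.norm_of_nonneg (by positivity), ← mul_pow, mul_pow]
    gcongr
    linarith
  · intro h
    have h1 : Integrable (fun ξ : EuclideanSpace ℝ (Fin n) =>
        2 ^ m * (1 + ((2 * Real.pi * ‖ξ‖) ^ 2) ^ m)) (spectralMeasure f) :=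
      ((integrable_const 1).add h).const_mul _
    refine h1.mono' (Continuous.aestronglyMeasurable (by fun_prop)) (Eventually.of_forall fun ξ => ?_)
    rw [Real.norm_of_nonneg (by positivity)]
    have h2 : ‖ξ‖ ^ 2 ≤ (2 * Real.pi * ‖ξ‖) ^ 2 := by
      refine pow_le_pow_left₀ (norm_nonneg _) ?_ 2
      refine le_mul_of_one_le_left (norm_nonneg _) ?_
      linarith [Real.pi_gt_three]
    set x := ‖ξ‖ ^ 2 with hx
    set y := (2 * Real.pi * ‖ξ‖) ^ 2 with hy
    have hx0 : 0 ≤ x := by positivity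
    rcases le_total x 1 with h3 | h3
    · calc (1 + x) ^ m ≤ 2 ^ m := by gcongr; linarith
        _ ≤ _ := le_mul_of_one_le_right (by positivity) (by
          have : 0 ≤ y ^ m := by positivity
          linarith)
    · calc (1 + x) ^ m ≤ (2 * y) ^ m := by gcongr; linarith
        _ = 2 ^ m * y ^ m := mul_pow _ _ _
        _ ≤ _ := by gcongr; linarith

theorem norm_absD_sq {m j : ℕ} (hj : j ≤ m) {f : L2 n} (hf : MemH (m : ℝ) f) :
    ‖absD j f‖ ^ 2 = ∫ ξ, ((2 * Real.pi * ‖ξ‖) ^ 2) ^ j ∂spectralMeasure f := by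
  have hm := (memH_natCast_iff m f).1 hf
  have hi : Integrable (fun ξ => ((2 * Real.pi * ‖ξ‖) ^ 2) ^ j) (spectralMeasure f) :=
    integrable_pow_of_le (Continuous.measurable (by fun_prop)) (fun ξ => sq_nonneg _) hj hm
  have he : ∀ ξ : EuclideanSpace ℝ (Fin n), ((2 * Real.pi * ‖ξ‖) ^ j) ^ 2 =
      ((2 * Real.pi * ‖ξ‖) ^ 2) ^ j := fun ξ => pow_right_comm _ _ _
  have hL : MemLp (fun ξ : EuclideanSpace ℝ (Fin n) =>
      (((2 * Real.pi * ‖ξ‖) ^ j : ℝ) : ℂ) * (𝓕 f : L2 n) ξ) 2 volume := by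
    rw [memLp_ofReal_mul_fourier_iff f (by fun_prop)]
    simpa only [he] using hi
  rw [absD, dif_pos hL]
  have h1 : ‖(𝓕⁻ hL.toLp : L2 n)‖ = ‖hL.toLp‖ :=
    (Lp.fourierTransformₗᵢ (EuclideanSpace ℝ (Fin n)) ℂ).symm.norm_map _
  have h2 : ((‖hL.toLp‖ ^ 2 : ℝ) : ℂ) = inner ℂ hL.toLp hL.toLp := by
    rw [inner_self_eq_norm_sq_to_K]
    push_cast
    rfl
  rw [h1]
  apply Complex.ofReal_injective
  rw [h2, L2.inner_def, integral_spectralMeasure, ← integral_complex_ofReal]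
  refine integral_congr_ae ?_
  filter_upwards [hL.coeFn_toLp] with ξ hξ
  have h3 : ‖(((2 * Real.pi * ‖ξ‖) ^ j : ℝ) : ℂ) * (𝓕 f : L2 n) ξ‖ ^ 2 =
      ‖(𝓕 f : L2 n) ξ‖ ^ 2 * ((2 * Real.pi * ‖ξ‖) ^ 2) ^ j := by
    rw [norm_mul, Complex.norm_real, mul_pow, Real.norm_eq_abs, sq_abs, he, mul_comm]
  rw [hξ, RCLike.inner_apply, RCLike.mul_conj, ← h3]
  exact (Complex.ofReal_pow _ 2).symm

end Sobolev

/-! ### The universal constants and the two directions of the theorem. -/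

section Expansion

/-- The universal constants in the expansion of the trace of `W2`. -/
def traceConst (j : ℕ) : ℝ :=
  (-1) ^ j / (j.factorial : ℝ) * ∫ s in simplex 1, timeWeight s ^ j

theorem simplex_one_nonempty : (simplex 1).Nonempty :=
  ⟨(1 / 3, 2 / 3), by norm_num [simplex]⟩

theorem integrableOn_timeWeight_pow (j : ℕ) :
    IntegrableOn (fun s => timeWeight s ^ j) (simplex 1) := by
  have h : IntegrableOn (fun s => timeWeight s ^ j) (Set.Icc (0 : ℝ × ℝ) (1, 1)) :=
    (continuous_timeWeight.pow j).continuousOn.integrableOn_compact isCompact_Icc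
  refine h.mono_set ?_
  rintro ⟨a, b⟩ ⟨h1, h2, h3⟩
  simp only at h1 h2 h3
  exact ⟨⟨h1.le, (h1.trans h2).le⟩, ⟨(h2.trans h3).le, h3.le⟩⟩

/-- The weight is strictly positive on the simplex, a nonempty open set, so every moment of it is
positive. -/
theorem traceConst_ne_zero (j : ℕ) : traceConst j ≠ 0 := by
  refine mul_ne_zero (div_ne_zero (pow_ne_zero _ (by norm_num)) (by positivity)) (ne_of_gt ?_)
  rw [setIntegral_pos_iff_support_of_nonneg_ae
    (Eventually.of_forall fun s => pow_nonneg (abs_nonneg _) j) (integrableOn_timeWeight_pow j)]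
  have h : simplex 1 ⊆ (Function.support fun s => timeWeight s ^ j) ∩ simplex 1 :=
    fun s hs => ⟨pow_ne_zero _ (timeWeight_of_mem hs).2.ne', hs⟩
  exact ((isOpen_simplex 1).measure_pos volume simplex_one_nonempty).trans_le (measure_mono h)

theorem laplaceCoeff_phase (f : L2 n) (j : ℕ) : laplaceCoeff (phaseMeasure f) phase j =
    traceConst j * ∫ ξ, ((2 * Real.pi * ‖ξ‖) ^ 2) ^ j ∂spectralMeasure f := by
  have h := integral_prod_mul (μ := volume.restrict (simplex 1)) (ν := spectralMeasure f)
    (fun s => timeWeight s ^ j) (fun ξ => ((2 * Real.pi * ‖ξ‖) ^ 2) ^ j)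
  rw [laplaceCoeff, traceConst, mul_assoc, ← h, phaseMeasure]
  simp only [phase, mul_pow]

theorem integrable_phase_pow_iff (f : L2 n) (j : ℕ) :
    Integrable (fun p => phase p ^ j) (phaseMeasure f) ↔
      Integrable (fun ξ => ((2 * Real.pi * ‖ξ‖) ^ 2) ^ j) (spectralMeasure f) := by
  have he : (fun p : (ℝ × ℝ) × EuclideanSpace ℝ (Fin n) => phase p ^ j) =
      fun p => timeWeight p.1 ^ j * ((2 * Real.pi * ‖p.2‖) ^ 2) ^ j := by
    funext p
    rw [phase, mul_pow]
  rw [he, phaseMeasure]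
  constructor
  · intro h
    have hne : volume.restrict (simplex 1) ≠ 0 := by
      rw [Ne, Measure.restrict_eq_zero]
      exact ((isOpen_simplex 1).measure_pos volume simplex_one_nonempty).ne'
    have := ae_neBot.2 hne
    -- Almost every slice is integrable and the simplex has positive measure, so some `s` in it has
    -- an integrable slice; its positive weight can be divided out.
    obtain ⟨s, hs, hs1⟩ := (h.prod_right_ae.and
      (ae_restrict_mem (isOpen_simplex 1).measurableSet)).exists
    have hw : timeWeight s ^ j ≠ 0 := pow_ne_zero _ (timeWeight_of_mem hs1).2.ne'
    exact (integrable_const_mul_iff (isUnit_iff_ne_zero.2 hw) _).1 hs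
  · exact fun h => (integrableOn_timeWeight_pow j).integrable.mul_prod h

variable {V : EuclideanSpace ℝ (Fin n) → ℝ} (hV : MemLp V ∞ volume) (hVc : HasCompactSupport V)

theorem traceExpansion_of_memH {m : ℕ} (h : MemH (m : ℝ) (potL2 V hV hVc)) :
    TraceExpansion traceConst m V hV hVc := by
  have hi := (integrable_phase_pow_iff (potL2 V hV hVc) m).2 ((memH_natCast_iff m _).1 h)
  obtain ⟨ε, hε, heq⟩ := laplace_expansion measurable_phase phase_nonneg hi
  refine ⟨fun t => (ε t : ℂ), ?_, fun t ht => ?_⟩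
  · have := (Complex.continuous_ofReal.tendsto 0).comp hε
    rwa [Complex.ofReal_zero] at this
  · rw [opTrace_W2_eq_laplace hV hVc ht, heq t ht]
    congr 1
    push_cast
    rw [add_mul, Finset.sum_mul]
    congr 1
    · refine Finset.sum_congr rfl fun j hj => ?_
      rw [laplaceCoeff_phase, ← norm_absD_sq (Nat.lt_succ_iff.1 (Finset.mem_range.1 hj)) h]
      push_cast
      ring
    · ring

/-- Cancelling `(4πt)^{-n/2} t²` leaves an expansion of the Laplace transform, and the gain of one
moment is the gain of one derivative. -/
theorem memH_succ_of_trace_expansion {m : ℕ} (h : MemH (m : ℝ) (potL2 V hV hVc)) (c : ℕ → ℂ)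
    (r : ℝ → ℂ) (C : ℝ) (hexp : ∀ t : ℝ, 0 < t → t ≤ 1 → ‖r t‖ ≤ C ∧
      opTrace (W2 V hV t) = (((4 * Real.pi * t) ^ (-(n : ℝ) / 2) : ℝ) : ℂ) *
        (∑ j ∈ Finset.range (m + 1), c j * (t : ℂ) ^ (2 + j) + r t * (t : ℂ) ^ (2 + (m + 1)))) :
    MemH ((m + 1 : ℕ) : ℝ) (potL2 V hV hVc) := by
  rw [memH_natCast_iff] at h ⊢
  rw [← integrable_phase_pow_iff] at h ⊢
  refine integrable_pow_succ_of_laplace_expansion measurable_phase phase_nonneg h c r C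
    fun t ht ht1 => ⟨(hexp t ht ht1).1, ?_⟩
  have h1 := (hexp t ht ht1).2
  rw [opTrace_W2_eq_laplace hV hVc ht] at h1
  have hpos : (0 : ℝ) < (4 * Real.pi * t) ^ (-(n : ℝ) / 2) := by positivity
  have h2 := mul_left_cancel₀ (Complex.ofReal_ne_zero.2 hpos.ne') h1
  have ht0 : (t : ℂ) ^ 2 ≠ 0 := pow_ne_zero _ (Complex.ofReal_ne_zero.2 ht.ne')
  refine mul_right_cancel₀ ht0 (h2.trans ?_)
  rw [add_mul, Finset.sum_mul]
  congr 1
  · refine Finset.sum_congr rfl fun j _ => ?_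
    ring
  · ring

theorem memH_zero (f : L2 n) : MemH ((0 : ℕ) : ℝ) f := by
  rw [memH_natCast_iff]
  simp

end Expansion

end HeatTrace

end

theorem mainTheorem4 :
    ∃ a : ℕ → ℝ, (∀ j, a j ≠ 0) ∧
      ∀ (n : ℕ), 1 ≤ n → ∀ (V : EuclideanSpace ℝ (Fin n) → ℝ)
        (hV : MemLp V ∞ volume) (hVc : HasCompactSupport V),
        (∀ t : ℝ, 0 < t → HeatTrace.IsTraceClass (HeatTrace.W2 V hV t)) ∧
        ∀ m : ℕ,
          (HeatTrace.MemH (m : ℝ) (HeatTrace.potL2 V hV hVc) →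
            HeatTrace.TraceExpansion a m V hV hVc) ∧
          (HeatTrace.MemH ((m : ℝ) - 1) (HeatTrace.potL2 V hV hVc) →
            (∃ (c : ℕ → ℂ) (r : ℝ → ℂ) (C : ℝ), ∀ t : ℝ, 0 < t → t ≤ 1 →
              ‖r t‖ ≤ C ∧
              HeatTrace.opTrace (HeatTrace.W2 V hV t) =
                (((4 * Real.pi * t) ^ (-(n : ℝ) / 2) : ℝ) : ℂ) *
                  (∑ j ∈ Finset.range m, c j * (t : ℂ) ^ (2 + j) + r t * (t : ℂ) ^ (2 + m))) →
            HeatTrace.MemH (m : ℝ) (HeatTrace.potL2 V hV hVc) ∧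
              HeatTrace.TraceExpansion a m V hV hVc) := by
  refine ⟨HeatTrace.traceConst, HeatTrace.traceConst_ne_zero, fun n _ V hV hVc =>
    ⟨fun t ht => HeatTrace.isTraceClass_W2 hV hVc ht, fun m =>
      ⟨HeatTrace.traceExpansion_of_memH hV hVc, fun hm hexp => ?_⟩⟩⟩
  have h : HeatTrace.MemH (m : ℝ) (HeatTrace.potL2 V hV hVc) := by
    cases m with
    -- For `m = 0` the claim is `V ∈ L²`, which is built into `potL2`.
    | zero => exact HeatTrace.memH_zero _
    | succ k =>
      obtain ⟨c, r, C, hc⟩ := hexp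
      rw [Nat.cast_succ, add_sub_cancel_right] at hm
      exact HeatTrace.memH_succ_of_trace_expansion hV hVc hm c r C hc
  exact ⟨h, HeatTrace.traceExpansion_of_memH hV hVc h⟩
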